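/- Let $R=\begin{pmatrix}a&b\\c&d\end{pmatrix}$ be a matrix of nonnegative integers that is balanced ($S:=a+b=c+d$), non triangular ($bc\neq 0$) and large ($m/S>1/2$, where $m:=a-c=d-b$). For $A\in\mathbb R$ let $\mathcal M_2(A)$ be the set of probability distributions on $\mathbb R$ with expectation $A$ and a finite second moment. A pair of distributions $(\mathcal L(X),\mathcal L(Y))$ on $\mathbb R$ is a solution of the system (E) when $$X\overset{\mathcal L}{=}U^{m}\Big(\sum_{k=1}^{a+1}X^{(k)}+\sum_{k=a+2}^{S+1}Y^{(k)}\Big),\qquad Y\overset{\mathcal L}{=}U^{m}\Big(\sum_{k=1}^{c}X^{(k)}+\sum_{k=c+1}^{S+1}Y^{(k)}\Big),$$ where $U$ is uniform on $[0,1]$, and the $X^{(k)}$ and $Y^{(k)}$ are respective copies of $X$ and $Y$, all independent of each other and of $U$. Let $(U^{CT}_{(\alpha,\beta)}(t))_{t\ge 0}$ be the continuous-time urn (two-type branching) process starting from $\alpha$ red and $\beta$ black balls: every ball carries an independent exponential clock of parameter $1$; when the clock of a red ball rings, $a$ red and $b$ black balls are added, when the clock of a black ball rings, $c$ red and $d$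 black balls are added, and the ball that rang as well as the added ones start fresh independent clocks. The components of $U^{CT}_{(\alpha,\beta)}(t)$ are the numbers of red and of black balls at time $t$. With $u_2(x,y)=\frac1S(bx-cy)$, put $$X^{CT}=\lim_{t\to+\infty}e^{-mt}u_2\big(U^{CT}_{(1,0)}(t)\big),\qquad Y^{CT}=\lim_{t\to+\infty}e^{-mt}u_2\big(U^{CT}_{(0,1)}(t)\big).$$ **Theorem.** (i) For all real numbers $B$ and $C$ with $cB+bC=0$, the system (E) has a unique solution in $\mathcal M_2(B)\times\mathcal M_2(C)$. (ii) Almost surely, the urn contains finitely many balls at every time, and the limits defining $X^{CT}$ and $Y^{CT}$ exist. The pair of the laws of $X^{CT}$ and $Y^{CT}$ is the unique solution of (E) in $\mathcal M_2(b/S)\times\mathcal M_2(-c/S)$. -/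

import Mathlib

open MeasureTheory ProbabilityTheory Filter Topology

noncomputable section

namespace PolyaUrn

/-- A two-colour replacement matrix with nonnegative integer entries: drawing a red ball adds
`a` red and `b` black balls, drawing a black ball adds `c` red and `d` black balls. -/
structure ReplacementMatrix where
  a : ℕ
  b : ℕ
  c : ℕ
  d : ℕ

namespace ReplacementMatrix

variable (R : ReplacementMatrix)

/-- The number of balls added at each drawing (for a balanced matrix). -/
def S : ℕ := R.a + R.b

/-- The second eigenvalue of the replacement matrix. -/
def m : ℤ := (R.a : ℤ) - R.c

/-- The ratio of the two eigenvalues. -/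
def sigma : ℝ := (R.m : ℝ) / R.S

/-- `a + b = c + d`. -/
def Balanced : Prop := R.a + R.b = R.c + R.d

end ReplacementMatrix

/-! ### The distributional system -/

/-- The set of probability distributions on `ℝ` with expectation `A` and a finite second moment. -/
def M2 (A : ℝ) : Set (Measure ℝ) :=
  {μ | IsProbabilityMeasure μ ∧ MemLp (fun x : ℝ => x) 2 μ ∧ ∫ x, x ∂μ = A}

/-- The law of `U ^ m * (X⁽¹⁾ + ⋯ + X⁽ᵖ⁾ + Y⁽¹⁾ + ⋯ + Y⁽ᵠ⁾)`, where `U` is uniform on `[0,1]`, the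
`p` variables `X⁽ᵏ⁾` have law `μ`, the `q` variables `Y⁽ᵏ⁾` have law `ν`, all independent. -/
def smoothing (m : ℤ) (p q : ℕ) (μ ν : Measure ℝ) : Measure ℝ :=
  ((volume.restrict (Set.Icc (0 : ℝ) 1)).prod
    ((Measure.pi fun _ : Fin p => μ).prod (Measure.pi fun _ : Fin q => ν))).map
      fun z : ℝ × (Fin p → ℝ) × (Fin q → ℝ) =>
        z.1 ^ m * ((∑ k, z.2.1 k) + ∑ k, z.2.2 k)

/-- The pair of laws `(μ, ν)` solves the continuous-time system: the first equation has `a + 1`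
copies of `X` and `b` copies of `Y`, the second one `c` copies of `X` and `d + 1` copies of `Y`. -/
def IsSolution (R : ReplacementMatrix) (μ ν : Measure ℝ) : Prop :=
  μ = smoothing R.m (R.a + 1) R.b μ ν ∧ ν = smoothing R.m R.c (R.d + 1) μ ν

/-! ### The continuous-time urn process

Balls are labelled by words over `{0, …, S}`: the initial ball is the empty word, and when the clock
of the ball `u` rings, `u` is replaced by the `S + 1` balls `u ++ [0], …, u ++ [S]`, each with a
fresh clock.  A red ball gives `a + 1` red and `b` black balls (itself and the added ones), a black
ball gives `c` red and `d + 1` black balls. -/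

inductive Color
  | red
  | black

/-- Labels of the balls. -/
abbrev Label (R : ReplacementMatrix) : Type := List (Fin (R.S + 1))

/-- A realisation of all the clocks. -/
abbrev Clocks (R : ReplacementMatrix) : Type := Label R → ℝ

/-- The law of the clocks: independent, exponentially distributed with parameter `1`. -/
def clockLaw (R : ReplacementMatrix) : Measure (Clocks R) :=
  Measure.infinitePi fun _ : Label R => expMeasure 1

/-- The colour of the `i`-th ball replacing a ball of the given colour. -/
def childColor (R : ReplacementMatrix) : Color → Fin (R.S + 1) → Color
  | .red, i => if (i : ℕ) < R.a + 1 then .red else .black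
  | .black, i => if (i : ℕ) < R.c then .red else .black

/-- The colour of the ball `u` when the initial ball has colour `root`. -/
def ballColor (R : ReplacementMatrix) (root : Color) (u : Label R) : Color :=
  u.foldl (childColor R) root

/-- The time at which the ball `u` appears: the sum of the clocks of its strict ancestors. -/
def birthTime {R : ReplacementMatrix} (ω : Clocks R) (u : Label R) : ℝ :=
  ∑ k ∈ Finset.range u.length, ω (u.take k)

/-- The balls present in the urn at time `t`. -/
def ballsAt {R : ReplacementMatrix} (ω : Clocks R) (t : ℝ) : Set (Label R) :=
  {u | birthTime ω u ≤ t ∧ t < birthTime ω u + ω u}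

/-- The composition (number of red balls, number of black balls) of the urn at time `t`, when the
urn initially contains one ball of colour `root`. -/
def compositionAt (R : ReplacementMatrix) (root : Color) (t : ℝ) (ω : Clocks R) : ℕ × ℕ :=
  ({u ∈ ballsAt ω t | ballColor R root u = .red}.ncard,
    {u ∈ ballsAt ω t | ballColor R root u = .black}.ncard)

/-- The linear form `u₂ (x, y) = (b x - c y) / S`. -/
def u2 (R : ReplacementMatrix) (z : ℕ × ℕ) : ℝ :=
  ((R.b : ℝ) * z.1 - R.c * z.2) / R.S

/-- The normalised second projection `exp (- m t) u₂ (U (t))` of the composition. -/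
def normalizedProj (R : ReplacementMatrix) (root : Color) (t : ℝ) (ω : Clocks R) : ℝ :=
  Real.exp (-(R.m : ℝ) * t) * u2 R (compositionAt R root t ω)

/-- The limit of the normalised second projection of the process. -/
def limitW (R : ReplacementMatrix) (root : Color) (ω : Clocks R) : ℝ :=
  limUnder atTop fun t : ℝ => normalizedProj R root t ω

/-- The law of the limit for the urn starting from one red ball. -/
def lawXCT (R : ReplacementMatrix) : Measure ℝ := (clockLaw R).map (limitW R .red)

/-- The law of the limit for the urn starting from one black ball. -/
def lawYCT (R : ReplacementMatrix) : Measure ℝ := (clockLaw R).map (limitW R .black)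

end PolyaUrn

end

noncomputable section

namespace PolyaUrn

/-! ### The exponential law -/

/-! The form `u2` is an eigenform of the replacement matrix, so a ball of value `v` is replaced by
balls of total value `(m + 1) v`. Each ball therefore carries a compensated one-jump martingale
`jumpProc`, run from its birth: the discounted value of the ball while it lives, then that of its
children, frozen at their birth. These contributions telescope along the genealogical tree, and
`normalizedProj_eq_tsum` writes the normalised projection at time `t` as the root value plus the sum
over the generations `n` of `genAt n t`.

Distinct balls of one generation have orthogonal contributions. As there are `(S + 1) ^ n` balls and
`E exp (-2 m b) = (2 m + 1) ^ (-n)` for a birth time `b` in generation `n`, the second moment of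
`genAt n t` is `O(ratio ^ n)`, with `ratio = (S + 1) / (2 m + 1)`. Largeness means exactly `ratio <
1`. A maximal inequality makes the bound uniform in `t`, Borel–Cantelli turns it into an almost sure
geometric bound, and dominated convergence lets `t` tend to infinity inside the sum over the
generations. The limit is also that of the martingale `genMart`, is bounded in `L²`, and has the
root value as its mean. Cutting the tree at the first split (`glue`) gives the system (E), since the
exponential of minus the first clock is uniform.

For uniqueness, the characteristic functions of two laws with the same mean and finite second
moments differ by `O(t ^ 2)`. Applying (E) multiplies the constant by `ratio`
(`norm_charFun_smoothing_sub_le`), so the difference vanishes. Since (E) is homogeneous, the other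
compatible means are reached by scaling the urn limits. -/

instance isProbabilityMeasure_expMeasure_one : IsProbabilityMeasure (expMeasure 1) :=
  isProbabilityMeasure_expMeasure one_pos

lemma integral_expMeasure_one {E : Type*} [NormedAddCommGroup E] [NormedSpace ℝ E] (f : ℝ → E) :
    ∫ x, f x ∂(expMeasure 1) = ∫ x in Set.Ioi (0 : ℝ), Real.exp (-x) • f x := by
  have h0 : expMeasure 1 = volume.withDensity (exponentialPDF 1) := rfl
  have hm : Measurable (exponentialPDF 1) :=
    (measurable_exponentialPDFReal 1).ennreal_ofReal
  rw [h0, integral_withDensity_eq_integral_toReal_smul hm (by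
    filter_upwards with x using by simp [exponentialPDF]),
    ← integral_Ici_eq_integral_Ioi, ← integral_indicator measurableSet_Ici]
  congr 1
  ext x
  by_cases hx : 0 ≤ x
  · rw [Set.indicator_of_mem (by simpa using hx), exponentialPDF_of_nonneg hx,
      ENNReal.toReal_ofReal (by positivity)]
    simp
  · rw [Set.indicator_of_notMem (by simpa using hx), exponentialPDF_of_neg (not_le.1 hx)]
    simp

lemma measureReal_expMeasure_one_Iic (x : ℝ) :
    (expMeasure 1).real (Set.Iic x) = if 0 ≤ x then 1 - Real.exp (-x) else 0 := by
  rw [← cdf_eq_real, cdf_expMeasure_eq one_pos]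
  simp

lemma ae_pos_expMeasure_one : ∀ᵐ x ∂(expMeasure 1), 0 < x := by
  have h := measureReal_expMeasure_one_Iic 0
  simp only [le_refl, if_true, neg_zero, Real.exp_zero, sub_self] at h
  rw [measureReal_eq_zero_iff] at h
  filter_upwards [compl_mem_ae_iff.2 h] with x hx
  simpa using hx

lemma integrable_exp_neg_mul_expMeasure_one (k : ℝ) (hk : 0 ≤ k) :
    Integrable (fun x => Real.exp (-k * x)) (expMeasure 1) := by
  refine Integrable.of_bound (by fun_prop) 1 ?_
  filter_upwards [ae_pos_expMeasure_one] with x hx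
  rw [Real.norm_eq_abs, Real.abs_exp, Real.exp_le_one_iff]
  nlinarith

lemma integral_exp_neg_mul_expMeasure_one (k : ℝ) (hk : 0 ≤ k) :
    ∫ x, Real.exp (-k * x) ∂(expMeasure 1) = 1 / (k + 1) := by
  rw [integral_expMeasure_one]
  have : ∀ x : ℝ, Real.exp (-x) • Real.exp (-k * x) = Real.exp (-(k + 1) * x) := by
    intro x
    rw [smul_eq_mul, ← Real.exp_add]
    ring_nf
  simp_rw [this]
  rw [integral_exp_mul_Ioi (by linarith), mul_zero, Real.exp_zero, neg_div, ← div_neg, neg_neg]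

/-- The exponential of minus an exponential variable is uniform. -/
lemma map_exp_neg_expMeasure_one :
    (expMeasure 1).map (fun x => Real.exp (-x)) = volume.restrict (Set.Icc (0 : ℝ) 1) := by
  have hm : Measurable fun x : ℝ => Real.exp (-x) := by fun_prop
  have : IsProbabilityMeasure ((expMeasure 1).map (fun x => Real.exp (-x))) :=
    Measure.isProbabilityMeasure_map hm.aemeasurable
  refine Measure.ext_of_Ici _ _ fun a => ?_
  rw [Measure.map_apply hm measurableSet_Ici, Measure.restrict_apply measurableSet_Ici]
  rcases le_or_gt a 0 with ha | ha
  · have h1 : (fun x : ℝ => Real.exp (-x)) ⁻¹' Set.Ici a = Set.univ := by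
      ext x
      simpa using ha.trans (Real.exp_pos _).le
    have h2 : Set.Ici a ∩ Set.Icc (0 : ℝ) 1 = Set.Icc 0 1 := by
      ext x
      simp only [Set.mem_inter_iff, Set.mem_Ici, Set.mem_Icc, and_iff_right_iff_imp]
      intro h
      linarith [h.1]
    rw [h1, h2]
    simp
  · have h2 : Set.Ici a ∩ Set.Icc (0 : ℝ) 1 = Set.Icc a 1 := by
      ext x
      simp only [Set.mem_inter_iff, Set.mem_Ici, Set.mem_Icc]
      exact ⟨fun h => ⟨h.1, h.2.2⟩, fun h => ⟨h.1, by linarith [h.1], h.2⟩⟩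
    have h1 : (fun x : ℝ => Real.exp (-x)) ⁻¹' Set.Ici a = Set.Iic (-Real.log a) := by
      ext x
      simp only [Set.mem_preimage, Set.mem_Ici, Set.mem_Iic]
      rw [← Real.log_le_iff_le_exp ha, le_neg]
    rw [h2, Real.volume_Icc, h1, ← ofReal_measureReal, measureReal_expMeasure_one_Iic]
    split_ifs with h
    · rw [neg_neg, Real.exp_log ha]
    · rw [ENNReal.ofReal_zero, eq_comm, ENNReal.ofReal_eq_zero]
      by_contra! h'
      exact h (by linarith [Real.log_nonpos ha.le (by linarith)])

/-! ### The one-jump martingale -/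

/-- The compensated single jump process: its value at time `s` when the jump occurs at time `x`. -/
def jumpProc (m s x : ℝ) : ℝ :=
  if s < x then Real.exp (-m * s) - 1 else (m + 1) * Real.exp (-m * x) - 1

lemma measurable_jumpProc (m : ℝ) : Measurable fun p : ℝ × ℝ => jumpProc m p.1 p.2 :=
  Measurable.ite (measurableSet_lt measurable_fst measurable_snd) (by fun_prop) (by fun_prop)

lemma jumpProc_of_lt {m s x : ℝ} (h : s < x) : jumpProc m s x = Real.exp (-m * s) - 1 := if_pos h

lemma jumpProc_of_le {m s x : ℝ} (h : x ≤ s) :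
    jumpProc m s x = (m + 1) * Real.exp (-m * x) - 1 := if_neg (not_lt.2 h)

lemma abs_jumpProc_le {m s x : ℝ} (hm : 0 ≤ m) (hs : 0 ≤ s) (hx : 0 ≤ x) :
    |jumpProc m s x| ≤ m + 2 := by
  have h (y : ℝ) (hy : 0 ≤ y) : 0 < Real.exp (-m * y) ∧ Real.exp (-m * y) ≤ 1 :=
    ⟨Real.exp_pos _, Real.exp_le_one_iff.2 (by nlinarith)⟩
  unfold jumpProc
  have := h s hs
  have := h x hx
  split_ifs <;> rw [abs_le] <;> constructor <;> nlinarith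

lemma continuousWithinAt_jumpProc (m s x : ℝ) :
    ContinuousWithinAt (fun s => jumpProc m s x) (Set.Ici s) s := by
  rcases lt_or_ge s x with h | h
  · refine ContinuousAt.continuousWithinAt ?_
    have : (fun s => jumpProc m s x) =ᶠ[𝓝 s] fun s => Real.exp (-m * s) - 1 := by
      filter_upwards [Iio_mem_nhds h] with y hy using jumpProc_of_lt hy
    exact ContinuousAt.congr (by fun_prop) this.symm
  · refine ContinuousWithinAt.congr (f := fun _ => (m + 1) * Real.exp (-m * x) - 1)
      continuousWithinAt_const (fun y hy => jumpProc_of_le (h.trans hy)) (jumpProc_of_le h)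

/-- The decay of `exp (-m s)` is compensated by a jump at rate `1` that multiplies the value by `m +
1`. The integral is split according to whether the jump occurs before or after `T`. -/
lemma integral_tail_jumpProc {m s T : ℝ} (hT : s ≤ T) :
    ∫ x in Set.Ioi s, Real.exp (-x) * (jumpProc m T x - jumpProc m s x) = 0 := by
  have e1 : Set.EqOn (fun x => Real.exp (-x) * (jumpProc m T x - jumpProc m s x))
      (fun x => (m + 1) * Real.exp (-(m + 1) * x) - Real.exp (-m * s) * Real.exp (-x))
      (Set.Ioc s T) := by
    intro x hx
    simp only [jumpProc_of_le hx.2, jumpProc_of_lt hx.1]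
    rw [show -(m + 1) * x = -x + -m * x by ring, Real.exp_add]
    ring
  have e2 : Set.EqOn (fun x => Real.exp (-x) * (jumpProc m T x - jumpProc m s x))
      (fun x => (Real.exp (-m * T) - Real.exp (-m * s)) * Real.exp (-x)) (Set.Ioi T) := by
    intro x hx
    simp only [jumpProc_of_lt hx, jumpProc_of_lt (hT.trans_lt hx)]
    ring
  have i2 : IntegrableOn (fun x => (Real.exp (-m * T) - Real.exp (-m * s)) * Real.exp (-x))
      (Set.Ioi T) := (integrableOn_exp_neg_Ioi T).const_mul _
  have i1 : IntegrableOn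
      (fun x => (m + 1) * Real.exp (-(m + 1) * x) - Real.exp (-m * s) * Real.exp (-x))
      (Set.Ioc s T) := (Continuous.integrableOn_Icc (by fun_prop)).mono_set Set.Ioc_subset_Icc_self
  rw [← Set.Ioc_union_Ioi_eq_Ioi hT, setIntegral_union (Set.Ioc_disjoint_Ioi le_rfl)
    measurableSet_Ioi (i1.congr_fun e1.symm measurableSet_Ioc)
    (i2.congr_fun e2.symm measurableSet_Ioi),
    setIntegral_congr_fun measurableSet_Ioc e1, setIntegral_congr_fun measurableSet_Ioi e2,
    integral_const_mul, integral_exp_neg_Ioi, ← intervalIntegral.integral_of_le hT]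
  have hd : ∀ x ∈ Set.uIcc s T, HasDerivAt
      (fun x => -Real.exp (-(m + 1) * x) + Real.exp (-m * s) * Real.exp (-x))
      ((m + 1) * Real.exp (-(m + 1) * x) - Real.exp (-m * s) * Real.exp (-x)) x := by
    intro x _
    have h1 := ((hasDerivAt_id x).const_mul (-(m + 1))).exp.neg
    have h2 := ((hasDerivAt_neg x).exp).const_mul (Real.exp (-m * s))
    convert! h1.add h2 using 1
    simp
    ring
  rw [intervalIntegral.integral_eq_sub_of_hasDerivAt hd
    (Continuous.intervalIntegrable (by fun_prop) _ _)]
  simp only [show ∀ y : ℝ, -(m + 1) * y = -m * y + -y by intro y; ring, Real.exp_add]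
  ring

/-- The martingale property of the single jump process, against a function of the jump time that
is determined by what happens up to time `s`. -/
lemma integral_mul_jumpProc_sub {m s T : ℝ} (hs : 0 ≤ s) (hT : s ≤ T)
    {φ : ℝ → ℝ} {κ : ℝ} (hφ : ∀ x, s < x → φ x = κ) :
    ∫ x, φ x * (jumpProc m T x - jumpProc m s x) ∂(expMeasure 1) = 0 := by
  -- A jump at or before `s` has frozen the process, so only `x > s` contributes, and there `φ` is
  -- the constant `κ`.
  have h1 : (fun x => φ x * (jumpProc m T x - jumpProc m s x)) =
      fun x => κ * (Set.Ioi s).indicator (fun x => jumpProc m T x - jumpProc m s x) x := by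
    ext x
    rcases lt_or_ge s x with h | h
    · rw [hφ x h, Set.indicator_of_mem (by exact h)]
    · rw [Set.indicator_of_notMem (by simpa using h), jumpProc_of_le h,
        jumpProc_of_le (h.trans hT)]
      simp
  rw [h1, integral_const_mul, integral_expMeasure_one]
  have h2 : ∀ x : ℝ, Real.exp (-x) •
      (Set.Ioi s).indicator (fun x => jumpProc m T x - jumpProc m s x) x =
      (Set.Ioi s).indicator (fun x => Real.exp (-x) * (jumpProc m T x - jumpProc m s x)) x := by
    intro x
    simp only [Set.indicator]
    split_ifs <;> simp
  simp_rw [h2]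
  rw [setIntegral_indicator measurableSet_Ioi, Set.Ioi_inter_Ioi, max_eq_right hs,
    integral_tail_jumpProc hT, mul_zero]

lemma integral_jumpProc {m T : ℝ} (hT : 0 ≤ T) :
    ∫ x, jumpProc m T x ∂(expMeasure 1) = 0 := by
  rw [← integral_mul_jumpProc_sub (m := m) le_rfl hT (φ := fun _ => 1) (κ := 1) (fun _ _ => rfl)]
  refine integral_congr_ae ?_
  filter_upwards [ae_pos_expMeasure_one] with x hx
  simp [jumpProc_of_lt hx]

lemma integral_jumpProc_limit {m : ℝ} (hm : 0 ≤ m) :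
    ∫ x, ((m + 1) * Real.exp (-m * x) - 1) ∂(expMeasure 1) = 0 := by
  rw [integral_sub ((integrable_exp_neg_mul_expMeasure_one m hm).const_mul _)
    (integrable_const _), integral_const_mul, integral_exp_neg_mul_expMeasure_one m hm]
  have : m + 1 ≠ 0 := by positivity
  simp [this]

/-! ### Resampling and gluing clocks -/

instance isProbabilityMeasure_clockLaw (R : ReplacementMatrix) :
    IsProbabilityMeasure (clockLaw R) := by
  unfold clockLaw
  infer_instance

lemma ae_clocks_pos (R : ReplacementMatrix) : ∀ᵐ ω ∂(clockLaw R), ∀ u : Label R, 0 < ω u := by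
  rw [ae_all_iff]
  intro u
  exact (measurePreserving_eval_infinitePi (fun _ : Label R => expMeasure 1) u).quasiMeasurePreserving.ae
    ae_pos_expMeasure_one

/-- Independence of the clocks in the form of resampling: replacing one clock by a fresh copy keeps
the law. This plays the role of conditioning on all the other clocks. -/
lemma measurePreserving_update (R : ReplacementMatrix) (u : Label R) :
    MeasurePreserving (fun p : Clocks R × ℝ => Function.update p.1 u p.2)
      ((clockLaw R).prod (expMeasure 1)) (clockLaw R) := by
  have hm : Measurable fun p : Clocks R × ℝ => Function.update p.1 u p.2 := by
    refine measurable_pi_iff.2 fun w => ?_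
    by_cases h : w = u
    · subst h
      simpa using measurable_snd
    · simp only [Function.update_of_ne h]
      fun_prop
  refine ⟨hm, Measure.eq_infinitePi _ fun s t ht => ?_⟩
  rw [Measure.map_apply hm (.pi s.countable_toSet fun i _ => ht i)]
  have hpre : (fun p : Clocks R × ℝ => Function.update p.1 u p.2) ⁻¹' (Set.pi s t) =
      Set.pi (s.erase u) t ×ˢ (if u ∈ s then t u else Set.univ) := by
    ext p
    simp only [Set.mem_preimage, Set.mem_pi, Finset.mem_coe, Set.mem_prod, Finset.mem_erase]
    constructor
    · intro h
      refine ⟨fun i hi => by simpa [Function.update_of_ne hi.1] using h i hi.2, ?_⟩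
      split_ifs with hu
      · simpa using h u hu
      · trivial
    · rintro ⟨h1, h2⟩ i hi
      by_cases hiu : i = u
      · subst hiu
        simpa [hi] using h2
      · rw [Function.update_of_ne hiu]
        exact h1 i ⟨hiu, hi⟩
  rw [hpre, Measure.prod_prod, clockLaw, Measure.infinitePi_pi _ (fun i _ => ht i)]
  split_ifs with hu
  · rw [Finset.prod_erase_mul _ _ hu]
  · rw [measure_univ, mul_one, Finset.erase_eq_of_notMem hu]

/-- Integrating out the clock of the ball `u`. -/
lemma integral_clockLaw_eq_update (R : ReplacementMatrix) (u : Label R) {f : Clocks R → ℝ}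
    (hf : Integrable f (clockLaw R)) :
    ∫ ω, f ω ∂(clockLaw R) =
      ∫ ω, ∫ x, f (Function.update ω u x) ∂(expMeasure 1) ∂(clockLaw R) := by
  have h := measurePreserving_update R u
  have h2 : Integrable (fun p : Clocks R × ℝ => f (Function.update p.1 u p.2))
      ((clockLaw R).prod (expMeasure 1)) := h.integrable_comp_of_integrable hf
  rw [← integral_prod _ h2]
  have hm := h.map_eq
  conv_lhs => rw [← hm]
  rw [integral_map h.measurable.aemeasurable (by rw [hm]; exact hf.1)]

variable {R : ReplacementMatrix}

/-- The clocks of the whole tree, from the clock of the root and the clocks of the subtrees. -/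
def glue (p : ℝ × (Fin (R.S + 1) → Clocks R)) : Clocks R
  | [] => p.1
  | i :: u => p.2 i u

@[simp] lemma glue_nil (p : ℝ × (Fin (R.S + 1) → Clocks R)) : glue p [] = p.1 := rfl

@[simp] lemma glue_cons (p : ℝ × (Fin (R.S + 1) → Clocks R)) (i : Fin (R.S + 1)) (u : Label R) :
    glue p (i :: u) = p.2 i u := rfl

lemma measurable_glue : Measurable (glue (R := R)) := by
  refine measurable_pi_iff.2 fun w => ?_
  cases w with
  | nil => simpa using measurable_fst
  | cons i u =>
    simp only [glue_cons]
    fun_prop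

/-- The branching property: the clock of the root and the clocks of the `S + 1` subtrees are
independent, and each subtree is a copy of the whole tree. -/
lemma measurePreserving_glue :
    MeasurePreserving (glue (R := R))
      ((expMeasure 1).prod (Measure.pi fun _ : Fin (R.S + 1) => clockLaw R)) (clockLaw R) := by
  refine ⟨measurable_glue, Measure.eq_infinitePi _ fun s t ht => ?_⟩
  rw [Measure.map_apply measurable_glue (.pi s.countable_toSet fun i _ => ht i)]
  -- The constrained labels that lie in the `i`-th subtree, with the first letter removed.
  let c : Fin (R.S + 1) → Finset (Label R) := fun i =>
    s.preimage (fun u => i :: u) (List.cons_injective.injOn)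
  have hpre : glue (R := R) ⁻¹' (Set.pi s t) =
      (if ([] : Label R) ∈ s then t [] else Set.univ) ×ˢ
        (Set.pi Set.univ fun i => Set.pi (c i) fun u => t (i :: u)) := by
    ext p
    simp only [Set.mem_preimage, Set.mem_pi, Finset.mem_coe, Set.mem_prod, Set.mem_univ,
      true_implies, c, Finset.mem_preimage]
    constructor
    · intro h
      refine ⟨?_, fun i u hu => h _ hu⟩
      split_ifs with hu
      · exact h _ hu
      · trivial
    · rintro ⟨h1, h2⟩ w hw
      cases w with
      | nil => simpa [hw] using h1
      | cons i u => exact h2 i u hw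
  have hs : s = s.filter (· = []) ∪
      Finset.univ.biUnion fun i => (c i).image fun u => i :: u := by
    ext w
    cases w <;> simp [c]
  have hd : Disjoint (s.filter (· = []))
      (Finset.univ.biUnion fun i => (c i).image fun u => i :: u) := by
    rw [Finset.disjoint_left]
    intro w hw
    simp only [Finset.mem_filter] at hw
    simp [hw.2]
  rw [hpre, Measure.prod_prod, Measure.pi_pi]
  conv_rhs => rw [hs, Finset.prod_union hd, Finset.prod_biUnion (by
    intro i _ j _ hij
    simp only [Function.onFun]
    rw [Finset.disjoint_left]
    intro w hw hw'
    simp only [Finset.mem_image] at hw hw'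
    obtain ⟨u, _, rfl⟩ := hw
    obtain ⟨v, _, h⟩ := hw'
    exact hij (List.cons.inj h).1.symm)]
  congr 1
  · by_cases h : ([] : Label R) ∈ s
    · have : s.filter (· = []) = {[]} := by
        ext w
        simp only [Finset.mem_filter, Finset.mem_singleton]
        exact ⟨fun h => h.2, fun h' => ⟨h' ▸ h, h'⟩⟩
      rw [if_pos h, this, Finset.prod_singleton]
    · have : s.filter (· = []) = ∅ := by
        ext w
        simp only [Finset.mem_filter, Finset.notMem_empty, iff_false, not_and]
        rintro hw rfl
        exact h hw
      rw [if_neg h, this, Finset.prod_empty, measure_univ]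
  · refine Finset.prod_congr rfl fun i _ => ?_
    rw [Finset.prod_image (by intro u _ v _ h; exact (List.cons.inj h).2), clockLaw,
      Measure.infinitePi_pi _ (fun u _ => ht _)]

/-! ### Birth times, colours and generations -/

lemma ballColor_append (root : Color) (u : Label R) (i : Fin (R.S + 1)) :
    ballColor R root (u ++ [i]) = childColor R (ballColor R root u) i := by
  simp [ballColor]

lemma ballColor_cons (root : Color) (u : Label R) (i : Fin (R.S + 1)) :
    ballColor R root (i :: u) = ballColor R (childColor R root i) u := by
  simp [ballColor]

@[simp] lemma birthTime_nil (ω : Clocks R) : birthTime ω [] = 0 := by simp [birthTime]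

lemma birthTime_append (ω : Clocks R) (u : Label R) (i : Fin (R.S + 1)) :
    birthTime ω (u ++ [i]) = birthTime ω u + ω u := by
  unfold birthTime
  rw [List.length_append, List.length_singleton, Finset.sum_range_succ]
  congr 1
  · refine Finset.sum_congr rfl fun k hk => ?_
    rw [List.take_append_of_le_length (Finset.mem_range.1 hk).le]
  · simp

lemma birthTime_glue_cons (p : ℝ × (Fin (R.S + 1) → Clocks R)) (u : Label R)
    (i : Fin (R.S + 1)) : birthTime (glue p) (i :: u) = p.1 + birthTime (p.2 i) u := by
  unfold birthTime
  rw [List.length_cons, Finset.sum_range_succ']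
  simp [add_comm]

lemma birthTime_nonneg {ω : Clocks R} (hω : ∀ u, 0 < ω u) (u : Label R) : 0 ≤ birthTime ω u :=
  Finset.sum_nonneg fun _ _ => (hω _).le

@[fun_prop]
lemma measurable_birthTime (u : Label R) : Measurable fun ω : Clocks R => birthTime ω u := by
  unfold birthTime
  fun_prop

/-- Only strict ancestors enter a birth time, and `u` is a strict ancestor of no label that is at
most as long as `u`. -/
lemma birthTime_update (ω : Clocks R) {u w : Label R} (h : w.length ≤ u.length) (x : ℝ) :
    birthTime (Function.update ω u x) w = birthTime ω w := by
  unfold birthTime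
  refine Finset.sum_congr rfl fun k hk => ?_
  rw [Function.update_of_ne]
  rintro rfl
  have := Finset.mem_range.1 hk
  simp only [List.length_take] at h
  omega

/-- The balls of the `n`-th generation. -/
def gen (R : ReplacementMatrix) (n : ℕ) : Finset (Label R) :=
  (List.finite_length_eq (Fin (R.S + 1)) n).toFinset

@[simp] lemma mem_gen {n : ℕ} {u : Label R} : u ∈ gen R n ↔ u.length = n := by simp [gen]

@[simp] lemma gen_zero : gen R 0 = {[]} := by
  ext u
  simp

lemma sum_gen_succ {E : Type*} [AddCommMonoid E] (n : ℕ) (f : Label R → E) :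
    ∑ u ∈ gen R (n + 1), f u = ∑ u ∈ gen R n, ∑ i, f (u ++ [i]) := by
  rw [← Finset.sum_product' (gen R n) Finset.univ fun u i => f (u ++ [i])]
  symm
  refine Finset.sum_bij (fun p _ => p.1 ++ [p.2]) ?_ ?_ ?_ ?_
  · intro p hp
    simpa using hp
  · intro p _ q _ h
    have := List.append_inj' h rfl
    exact Prod.ext this.1 (by simpa using this.2)
  · intro u hu
    have hu' : u ≠ [] := by
      rintro rfl
      simp at hu
    refine ⟨(u.dropLast, u.getLast hu'), ?_, List.dropLast_append_getLast hu'⟩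
    simp at hu ⊢
    omega
  · intros
    rfl

lemma sum_gen_succ_cons {E : Type*} [AddCommMonoid E] (n : ℕ) (f : Label R → E) :
    ∑ u ∈ gen R (n + 1), f u = ∑ i, ∑ u ∈ gen R n, f (i :: u) := by
  rw [← Finset.sum_product' Finset.univ (gen R n) fun i u => f (i :: u)]
  symm
  refine Finset.sum_bij (fun p _ => p.1 :: p.2) ?_ ?_ ?_ ?_
  · intro p hp
    simpa using hp
  · intro p _ q _ h
    have := List.cons.inj h
    exact Prod.ext this.1 this.2
  · intro u hu
    cases u with
    | nil => simp at hu
    | cons i w => exact ⟨(i, w), by simpa using hu, rfl⟩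
  · intros
    rfl

/-! ### The eigenform and the colours of the children -/

/-- The value of the second eigenform at one ball of the given colour. -/
def colorVal (R : ReplacementMatrix) : Color → ℝ
  | .red => (R.b : ℝ) / R.S
  | .black => -((R.c : ℝ) / R.S)

lemma card_filter_lt {n p : ℕ} (h : p ≤ n) :
    (Finset.univ.filter fun i : Fin n => (i : ℕ) < p).card = p := by
  rw [Fin.card_filter_val_lt, min_eq_right h]

lemma card_filter_not_lt {n p q : ℕ} (h : p + q = n) :
    (Finset.univ.filter fun i : Fin n => ¬ (i : ℕ) < p).card = q := by
  have := Finset.card_filter_add_card_filter_not (s := Finset.univ) (fun i : Fin n => (i : ℕ) < p)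
  rw [card_filter_lt (by omega), Finset.card_univ, Fintype.card_fin] at this
  omega

/-- The number of red balls among those replacing a ball of the given colour. -/
def redCount (R : ReplacementMatrix) : Color → ℕ
  | .red => R.a + 1
  | .black => R.c

/-- The number of black balls among those replacing a ball of the given colour. -/
def blackCount (R : ReplacementMatrix) : Color → ℕ
  | .red => R.b
  | .black => R.d + 1

lemma redCount_add_blackCount (hbal : R.Balanced) (κ : Color) :
    redCount R κ + blackCount R κ = R.S + 1 := by
  unfold ReplacementMatrix.Balanced at hbal
  cases κ <;> simp only [redCount, blackCount, ReplacementMatrix.S] <;> omega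

lemma childColor_eq (κ : Color) (i : Fin (R.S + 1)) :
    childColor R κ i = if (i : ℕ) < redCount R κ then .red else .black := by
  cases κ <;> rfl

lemma prod_childColor {E : Type*} [CommMonoid E] (hbal : R.Balanced) (κ : Color)
    (f : Color → E) :
    ∏ i, f (childColor R κ i) = f .red ^ redCount R κ * f .black ^ blackCount R κ := by
  have h := redCount_add_blackCount hbal κ
  simp_rw [childColor_eq, apply_ite f]
  rw [Finset.prod_ite, Finset.prod_const, Finset.prod_const, card_filter_lt (by omega),
    card_filter_not_lt h]

lemma sum_childColor (hbal : R.Balanced) (κ : Color) (f : Color → ℝ) :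
    ∑ i, f (childColor R κ i) = redCount R κ * f .red + blackCount R κ * f .black := by
  have h := redCount_add_blackCount hbal κ
  simp_rw [childColor_eq, apply_ite f]
  rw [Finset.sum_ite, Finset.sum_const, Finset.sum_const, card_filter_lt (by omega),
    card_filter_not_lt h, nsmul_eq_mul, nsmul_eq_mul]

/-- By balance, `(b, -c)` is an eigenvector of the matrix for the eigenvalue `m`. The extra `1`
counts the ball that rang, which stays in the urn. -/
lemma sum_colorVal_childColor (hbal : R.Balanced) (κ : Color) :
    ∑ i, colorVal R (childColor R κ i) = ((R.m : ℝ) + 1) * colorVal R κ := by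
  rw [sum_childColor hbal]
  have h : (R.a : ℝ) + R.b = R.c + R.d := by exact_mod_cast hbal
  have h2 : (R.d : ℝ) = R.a + R.b - R.c := by linarith
  cases κ <;> simp only [redCount, blackCount, colorVal, ReplacementMatrix.m] <;> push_cast
  · ring
  · rw [h2]
    ring

/-! ### A maximal inequality -/

/-- The event that a sequence exceeds the level `ε` for the first time at the index `k`. -/
def firstPassage {Ω : Type*} (Z : ℕ → Ω → ℝ) (ε : ℝ) (k : ℕ) : Set Ω :=
  {ω | ε ≤ |Z k ω| ∧ ∀ j < k, |Z j ω| < ε}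

lemma measurableSet_firstPassage {Ω : Type*} [MeasurableSpace Ω] {Z : ℕ → Ω → ℝ}
    (hZ : ∀ k, Measurable (Z k)) (ε : ℝ) (k : ℕ) : MeasurableSet (firstPassage Z ε k) := by
  have h (j : ℕ) : Measurable fun ω => |Z j ω| := (hZ j).abs
  refine (measurableSet_le measurable_const (h k)).inter ?_
  have : {ω | ∀ j < k, |Z j ω| < ε} = ⋂ j, ⋂ _ : j < k, {ω | |Z j ω| < ε} := by
    ext ω
    simp
  change MeasurableSet {ω | ∀ j < k, |Z j ω| < ε}
  rw [this]
  exact .iInter fun j => .iInter fun _ => measurableSet_lt (h j) measurable_const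

/-- Kolmogorov's maximal inequality, for a sequence whose increments are orthogonal to what happens
before the first passage. -/
lemma sq_mul_measureReal_exists_le_integral_sq {Ω : Type*} [MeasurableSpace Ω] {P : Measure Ω}
    [IsProbabilityMeasure P] {Z : ℕ → Ω → ℝ} (hZ : ∀ k, Measurable (Z k))
    (hL : ∀ k, MemLp (Z k) 2 P) {ε : ℝ} (hε : 0 ≤ ε) (K : ℕ)
    (horth : ∀ k ≤ K, ∫ ω in firstPassage Z ε k, Z k ω * (Z K ω - Z k ω) ∂P = 0) :
    ε ^ 2 * P.real {ω | ∃ k ≤ K, ε ≤ |Z k ω|} ≤ ∫ ω, Z K ω ^ 2 ∂P := by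
  have hset : {ω | ∃ k ≤ K, ε ≤ |Z k ω|} =
      ⋃ k ∈ Finset.range (K + 1), firstPassage Z ε k := by
    ext ω
    simp only [Set.mem_ofPred_eq, Set.mem_iUnion, Finset.mem_range, exists_prop, firstPassage]
    constructor
    · intro h
      classical
      have hex : ∃ k, ε ≤ |Z k ω| := ⟨h.choose, h.choose_spec.2⟩
      refine ⟨Nat.find hex, ?_, Nat.find_spec hex, fun j hj => not_le.1 (Nat.find_min hex hj)⟩
      exact Nat.lt_succ_of_le ((Nat.find_min' hex h.choose_spec.2).trans h.choose_spec.1)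
    · rintro ⟨k, hk, h, _⟩
      exact ⟨k, Nat.le_of_lt_succ hk, h⟩
  have hdisj : Set.PairwiseDisjoint (↑(Finset.range (K + 1))) (firstPassage Z ε) := by
    intro i _ j _ hij
    refine Set.disjoint_left.2 fun ω hi hj => ?_
    rcases lt_or_gt_of_ne hij with h | h
    · exact absurd hi.1 (not_le.2 (hj.2 i h))
    · exact absurd hj.1 (not_le.2 (hi.2 j h))
  have hmeas := measurableSet_firstPassage hZ ε
  have hsq : ∀ k, Integrable (fun ω => Z k ω ^ 2) P := fun k => (hL k).integrable_sq
  have hmul : ∀ k, Integrable (fun ω => Z k ω * (Z K ω - Z k ω)) P := fun k =>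
    (hL k).integrable_mul ((hL K).sub (hL k))
  rw [hset, measureReal_biUnion_finset hdisj (fun k _ => hmeas k), Finset.mul_sum]
  calc ∑ k ∈ Finset.range (K + 1), ε ^ 2 * P.real (firstPassage Z ε k)
      ≤ ∑ k ∈ Finset.range (K + 1), ∫ ω in firstPassage Z ε k, Z K ω ^ 2 ∂P := by
        refine Finset.sum_le_sum fun k hk => ?_
        have h1 : ∫ ω in firstPassage Z ε k, (Z k ω ^ 2 + 2 * (Z k ω * (Z K ω - Z k ω))) ∂P ≤
            ∫ ω in firstPassage Z ε k, Z K ω ^ 2 ∂P := by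
          refine setIntegral_mono (((hsq k).add ((hmul k).const_mul 2)).integrableOn)
            (hsq K).integrableOn fun ω => ?_
          -- Expand the square of `Z K = Z k + (Z K - Z k)`. The cross term integrates to zero by
          -- `horth`.
          nlinarith [sq_nonneg (Z K ω - Z k ω)]
        rw [integral_add (hsq k).integrableOn ((hmul k).const_mul 2).integrableOn,
          integral_const_mul, horth k (Nat.le_of_lt_succ (Finset.mem_range.1 hk)), mul_zero,
          add_zero] at h1
        refine le_trans ?_ h1
        have h2 : ∫ _ in firstPassage Z ε k, ε ^ 2 ∂P = ε ^ 2 * P.real (firstPassage Z ε k) := by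
          rw [setIntegral_const, smul_eq_mul, mul_comm]
        rw [← h2]
        refine setIntegral_mono_on (integrable_const _).integrableOn (hsq k).integrableOn
          (hmeas k) fun ω hω => ?_
        rw [← sq_abs (Z k ω)]
        exact pow_le_pow_left₀ hε hω.1 2
    _ = ∫ ω in ⋃ k ∈ Finset.range (K + 1), firstPassage Z ε k, Z K ω ^ 2 ∂P :=
        (integral_biUnion_finset _ (fun k _ => hmeas k) hdisj fun k _ => (hsq K).integrableOn).symm
    _ ≤ ∫ ω, Z K ω ^ 2 ∂P :=
        setIntegral_le_integral (hsq K) (.of_forall fun ω => sq_nonneg _)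

/-! ### The increments of the martingale, ball by ball and generation by generation -/


/-- A bound for the values of the second eigenform at one ball. -/
def colorBound (R : ReplacementMatrix) : ℝ := |colorVal R .red| + |colorVal R .black|

lemma abs_colorVal_le (κ : Color) : |colorVal R κ| ≤ colorBound R := by
  cases κ <;> simp [colorBound]

lemma colorBound_nonneg : 0 ≤ colorBound R := by unfold colorBound; positivity

/-- The contribution of the ball `u` when its clock and its birth time are evaluated by `h`. -/
def ballInc (R : ReplacementMatrix) (root : Color) (h : ℝ → ℝ → ℝ) (u : Label R)
    (ω : Clocks R) : ℝ :=
  Real.exp (-(R.m : ℝ) * birthTime ω u) * colorVal R (ballColor R root u) *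
    h (birthTime ω u) (ω u)

/-- The contribution of the `n`-th generation. -/
def genInc (R : ReplacementMatrix) (root : Color) (h : ℝ → ℝ → ℝ) (n : ℕ) (ω : Clocks R) : ℝ :=
  ∑ u ∈ gen R n, ballInc R root h u ω

/-- Admissible evaluations: measurable, bounded and centred with respect to the clock. -/
structure Centred (h : ℝ → ℝ → ℝ) (K : ℝ) : Prop where
  measurable : Measurable fun p : ℝ × ℝ => h p.1 p.2
  abs_le : ∀ b x, 0 ≤ b → 0 < x → |h b x| ≤ K
  integral_eq_zero : ∀ b, 0 ≤ b → ∫ x, h b x ∂(expMeasure 1) = 0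

/-- The age is truncated at `0`, so that a ball not yet born at time `t` contributes `jumpProc` at
time `0`, which vanishes for a positive clock. -/
lemma centred_jumpProc {m t : ℝ} (hm : 0 ≤ m) :
    Centred (fun b x => jumpProc m (max (t - b) 0) x) (m + 2) where
  measurable := (measurable_jumpProc m).comp
    (Measurable.prodMk ((measurable_const.sub measurable_fst).max measurable_const) measurable_snd)
  abs_le _ _ _ hx := abs_jumpProc_le hm (le_max_right _ _) hx.le
  integral_eq_zero _ _ := integral_jumpProc (le_max_right _ _)

lemma centred_limit {m : ℝ} (hm : 0 ≤ m) :
    Centred (fun _ x => (m + 1) * Real.exp (-m * x) - 1) (m + 2) where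
  measurable := by fun_prop
  abs_le _ _ _ hx := by
    rw [← jumpProc_of_le le_rfl]
    exact abs_jumpProc_le hm hx.le hx.le
  integral_eq_zero _ _ := integral_jumpProc_limit hm

variable {root : Color} {h : ℝ → ℝ → ℝ} {K : ℝ}

lemma measurable_ballInc (hh : Measurable fun p : ℝ × ℝ => h p.1 p.2) (u : Label R) :
    Measurable (ballInc R root h u) := by
  have h1 : Measurable fun ω : Clocks R => h (birthTime ω u) (ω u) :=
    hh.comp ((measurable_birthTime u).prodMk (measurable_pi_apply u))
  unfold ballInc
  fun_prop

lemma measurable_genInc (hh : Measurable fun p : ℝ × ℝ => h p.1 p.2) (n : ℕ) :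
    Measurable (genInc R root h n) :=
  Finset.measurable_fun_sum _ fun u _ => measurable_ballInc hh u

lemma ballInc_update (ω : Clocks R) (u : Label R) (x : ℝ) :
    ballInc R root h u (Function.update ω u x) =
      Real.exp (-(R.m : ℝ) * birthTime ω u) * colorVal R (ballColor R root u) *
        h (birthTime ω u) x := by
  simp [ballInc, birthTime_update ω (le_refl u.length)]

lemma ballInc_update_of_ne (ω : Clocks R) {u w : Label R} (hl : w.length = u.length)
    (hne : w ≠ u) (x : ℝ) :
    ballInc R root h w (Function.update ω u x) = ballInc R root h w ω := by
  simp [ballInc, birthTime_update ω hl.le, Function.update_of_ne hne]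

lemma abs_ballInc_le (hh : ∀ b x, 0 ≤ b → 0 < x → |h b x| ≤ K)
    {ω : Clocks R} (hω : ∀ u, 0 < ω u) (u : Label R) :
    |ballInc R root h u ω| ≤
      Real.exp (-(R.m : ℝ) * birthTime ω u) * (colorBound R * K) := by
  unfold ballInc
  rw [abs_mul, abs_mul, Real.abs_exp, mul_assoc]
  gcongr
  · exact colorBound_nonneg
  · exact abs_colorVal_le _
  · exact hh _ _ (birthTime_nonneg hω u) (hω u)

lemma abs_ballInc_le' (hm : (0 : ℝ) ≤ R.m) (hh : ∀ b x, 0 ≤ b → 0 < x → |h b x| ≤ K)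
    {ω : Clocks R} (hω : ∀ u, 0 < ω u) (u : Label R) :
    |ballInc R root h u ω| ≤ colorBound R * K := by
  have hK : 0 ≤ K := (abs_nonneg _).trans (hh 0 1 le_rfl one_pos)
  refine (abs_ballInc_le hh hω u).trans (mul_le_of_le_one_left
    (mul_nonneg colorBound_nonneg hK) (Real.exp_le_one_iff.2 ?_))
  nlinarith [birthTime_nonneg hω u]

lemma memLp_ballInc (hm : (0 : ℝ) ≤ R.m) (hh : Centred h K) (u : Label R) :
    MemLp (ballInc R root h u) 2 (clockLaw R) := by
  refine MemLp.of_bound (measurable_ballInc hh.measurable u).aestronglyMeasurable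
    (colorBound R * K) ?_
  filter_upwards [ae_clocks_pos R] with ω hω
  exact abs_ballInc_le' hm hh.abs_le hω u

lemma memLp_genInc (hm : (0 : ℝ) ≤ R.m) (hh : Centred h K) (n : ℕ) :
    MemLp (genInc R root h n) 2 (clockLaw R) :=
  memLp_finsetSum _ fun u _ => memLp_ballInc hm hh u

lemma integral_genInc (hm : (0 : ℝ) ≤ R.m) (hh : Centred h K) (n : ℕ) :
    ∫ ω, genInc R root h n ω ∂(clockLaw R) = 0 := by
  have hi (u : Label R) := (memLp_ballInc (root := root) hm hh u).integrable one_le_two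
  unfold genInc
  rw [integral_finsetSum _ fun u _ => hi u]
  refine Finset.sum_eq_zero fun u _ => ?_
  rw [integral_clockLaw_eq_update R u (hi u)]
  refine integral_eq_zero_of_ae ?_
  filter_upwards [ae_clocks_pos R] with ω hω
  simp_rw [ballInc_update]
  rw [integral_const_mul, hh.integral_eq_zero _ (birthTime_nonneg hω u), mul_zero]
  rfl

/-- Resample the clock of `u`: the factor of `w` does not see it, and the factor of `u` is centred
in it. -/
lemma integral_ballInc_mul_ballInc (hm : (0 : ℝ) ≤ R.m) (hh : Centred h K) {u w : Label R}
    (hl : w.length = u.length) (hne : w ≠ u) :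
    ∫ ω, ballInc R root h u ω * ballInc R root h w ω ∂(clockLaw R) = 0 := by
  refine (integral_clockLaw_eq_update R u ((memLp_ballInc hm hh u).integrable_mul
    (memLp_ballInc hm hh w))).trans (integral_eq_zero_of_ae ?_)
  filter_upwards [ae_clocks_pos R] with ω hω
  simp_rw [Pi.mul_apply, ballInc_update, ballInc_update_of_ne ω hl hne]
  rw [integral_mul_const, integral_const_mul, hh.integral_eq_zero _ (birthTime_nonneg hω u),
    mul_zero, zero_mul]
  rfl

lemma integrable_exp_birthTime (hm : (0 : ℝ) ≤ R.m) (u : Label R) :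
    Integrable (fun ω : Clocks R => Real.exp (-(2 * (R.m : ℝ)) * birthTime ω u))
      (clockLaw R) := by
  refine Integrable.of_bound (by fun_prop) 1 ?_
  filter_upwards [ae_clocks_pos R] with ω hω
  rw [Real.norm_eq_abs, Real.abs_exp, Real.exp_le_one_iff]
  nlinarith [birthTime_nonneg hω u]

/-- The birth time is a sum of `u.length` independent exponential clocks, each with Laplace
transform `1 / (2 m + 1)` at `2 m`. -/
lemma integral_exp_birthTime (hm : (0 : ℝ) ≤ R.m) (u : Label R) :
    ∫ ω, Real.exp (-(2 * (R.m : ℝ)) * birthTime ω u) ∂(clockLaw R) =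
      (1 / (2 * (R.m : ℝ) + 1)) ^ u.length := by
  induction u using List.reverseRecOn with
  | nil => simp
  | append_singleton u i ih =>
    rw [integral_clockLaw_eq_update R u (integrable_exp_birthTime hm _), List.length_append,
      List.length_singleton, pow_succ, ← ih, ← integral_mul_const]
    congr 1
    ext ω
    simp_rw [birthTime_append, birthTime_update ω (le_refl u.length), Function.update_self,
      mul_add, Real.exp_add]
    rw [integral_const_mul, integral_exp_neg_mul_expMeasure_one _ (by positivity)]

lemma card_gen (n : ℕ) : (gen R n).card = (R.S + 1) ^ n := by
  induction n with
  | zero => simp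
  | succ n ih =>
    rw [Finset.card_eq_sum_ones, sum_gen_succ]
    simp [ih, pow_succ]

/-- The contraction factor. -/
def ratio (R : ReplacementMatrix) : ℝ := ((R.S : ℝ) + 1) / (2 * R.m + 1)

lemma sum_integral_exp_birthTime (hm : (0 : ℝ) ≤ R.m) (n : ℕ) :
    ∑ u ∈ gen R n, ∫ ω, Real.exp (-(2 * (R.m : ℝ)) * birthTime ω u) ∂(clockLaw R) =
      ratio R ^ n := by
  rw [Finset.sum_congr rfl fun u hu => by
    rw [integral_exp_birthTime hm u, mem_gen.1 hu], Finset.sum_const, card_gen, nsmul_eq_mul,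
    ratio, div_pow, div_pow]
  push_cast
  ring

/-- Orthogonality leaves only the diagonal terms, each bounded by a constant times `exp (-2 m b)`,
where `b` is the birth time. -/
lemma integral_genInc_sq_le (hm : (0 : ℝ) ≤ R.m) (hh : Centred h K) (n : ℕ) :
    ∫ ω, genInc R root h n ω ^ 2 ∂(clockLaw R) ≤ (colorBound R * K) ^ 2 * ratio R ^ n := by
  have hL (u : Label R) := memLp_ballInc (root := root) hm hh u
  have hi (u w : Label R) : Integrable
      (fun ω => ballInc R root h u ω * ballInc R root h w ω) (clockLaw R) :=
    (hL u).integrable_mul (hL w)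
  have e1 : ∀ ω, genInc R root h n ω ^ 2 =
      ∑ u ∈ gen R n, ∑ w ∈ gen R n, ballInc R root h u ω * ballInc R root h w ω := by
    intro ω
    rw [genInc, sq, Finset.sum_mul_sum]
  simp_rw [e1]
  rw [integral_finsetSum _ fun u _ => integrable_finsetSum _ fun w _ => hi u w,
    ← sum_integral_exp_birthTime hm, Finset.mul_sum]
  refine Finset.sum_le_sum fun u hu => ?_
  rw [integral_finsetSum _ fun w _ => hi u w, Finset.sum_eq_single u (fun w hw hne =>
    integral_ballInc_mul_ballInc hm hh ((mem_gen.1 hw).trans (mem_gen.1 hu).symm) hne)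
    (fun h' => absurd hu h'), ← integral_const_mul]
  refine integral_mono_ae (hi u u) ((integrable_exp_birthTime hm u).const_mul _) ?_
  filter_upwards [ae_clocks_pos R] with ω hω
  have h1 := abs_ballInc_le (root := root) hh.abs_le hω u
  rw [← pow_two, ← sq_abs]
  refine (pow_le_pow_left₀ (abs_nonneg _) h1 2).trans (le_of_eq ?_)
  rw [mul_pow, ← Real.exp_nat_mul, mul_comm]
  congr 2
  push_cast
  ring

/-! ### Uniform control of one generation -/

/-- The contribution of the `n`-th generation to the urn at time `t`. -/
def genAt (R : ReplacementMatrix) (root : Color) (n : ℕ) (t : ℝ) : Clocks R → ℝ :=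
  genInc R root (fun b x => jumpProc R.m (max (t - b) 0) x) n

/-- The contribution of the `n`-th generation to the limit. -/
def genLim (R : ReplacementMatrix) (root : Color) (n : ℕ) : Clocks R → ℝ :=
  genInc R root (fun _ x => ((R.m : ℝ) + 1) * Real.exp (-(R.m : ℝ) * x) - 1) n

lemma measurable_genAt (hm : (0 : ℝ) ≤ R.m) (n : ℕ) (t : ℝ) : Measurable (genAt R root n t) :=
  measurable_genInc (centred_jumpProc hm).measurable n

/-- Adaptedness: as long as the clock of `u` rings after time `s`, its exact value is invisible to
the `n`-th generation up to `s`. -/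
lemma genAt_update_eq {n : ℕ} {u : Label R} (hu : u ∈ gen R n) (ω : Clocks R) {s s' x y : ℝ}
    (hs : s' ≤ s) (hx : max (s - birthTime ω u) 0 < x) (hy : max (s - birthTime ω u) 0 < y) :
    genAt R root n s' (Function.update ω u x) = genAt R root n s' (Function.update ω u y) := by
  unfold genAt genInc
  refine Finset.sum_congr rfl fun w hw => ?_
  by_cases hwu : w = u
  · subst hwu
    have h' : max (s' - birthTime ω w) 0 ≤ max (s - birthTime ω w) 0 :=
      max_le_max_right _ (by linarith)
    rw [ballInc_update, ballInc_update, jumpProc_of_lt (h'.trans_lt hx),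
      jumpProc_of_lt (h'.trans_lt hy)]
  · have hl := (mem_gen.1 hw).trans (mem_gen.1 hu).symm
    rw [ballInc_update_of_ne ω hl hwu, ballInc_update_of_ne ω hl hwu]

lemma measureReal_exists_genAt_le (hm : (0 : ℝ) ≤ R.m) (n : ℕ) {t : ℕ → ℝ} (ht : Monotone t)
    {ε : ℝ} (hε : 0 ≤ ε) (N : ℕ) :
    ε ^ 2 * (clockLaw R).real {ω | ∃ k ≤ N, ε ≤ |genAt R root n (t k) ω|} ≤
      (colorBound R * (R.m + 2)) ^ 2 * ratio R ^ n := by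
  refine le_trans ?_ (integral_genInc_sq_le (root := root) hm (centred_jumpProc (t := t N) hm) n)
  have hmeas : ∀ k, Measurable (genAt R root n (t k)) := fun k => measurable_genAt hm n _
  refine sq_mul_measureReal_exists_le_integral_sq hmeas
    (fun k => memLp_genInc hm (centred_jumpProc hm) n) hε N fun k hk => ?_
  have hA := measurableSet_firstPassage hmeas ε k
  set A := firstPassage (fun k => genAt R root n (t k)) ε k with hAdef
  -- `Φ` depends only on the generation observed at the times `t j`, `j ≤ k`. This makes it an
  -- admissible test function for the one-jump martingale of each ball.
  set Φ : Clocks R → ℝ := A.indicator (genAt R root n (t k)) with hΦ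
  have hΦL : MemLp Φ 2 (clockLaw R) := (memLp_genInc hm (centred_jumpProc hm) n).indicator hA
  have hΦeq : ∀ ω ω', (∀ j ≤ k, genAt R root n (t j) ω = genAt R root n (t j) ω') →
      Φ ω = Φ ω' := by
    intro ω ω' hj
    have hAA : ω ∈ A ↔ ω' ∈ A := by
      simp only [hAdef, firstPassage, Set.mem_ofPred_eq, hj k le_rfl]
      refine and_congr_right fun _ => forall₂_congr fun j hjk => ?_
      rw [hj j hjk.le]
    by_cases hω : ω ∈ A
    · rw [hΦ, Set.indicator_of_mem hω, Set.indicator_of_mem (hAA.1 hω), hj k le_rfl]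
    · rw [hΦ, Set.indicator_of_notMem hω, Set.indicator_of_notMem (fun h => hω (hAA.2 h))]
  have hbL (s : ℝ) (u : Label R) := memLp_ballInc (root := root) hm (centred_jumpProc (t := s) hm) u
  rw [← integral_indicator hA]
  have e1 : ∀ ω, A.indicator (fun ω => genAt R root n (t k) ω *
      (genAt R root n (t N) ω - genAt R root n (t k) ω)) ω = ∑ u ∈ gen R n, Φ ω *
        (ballInc R root (fun b x => jumpProc R.m (max (t N - b) 0) x) u ω -
          ballInc R root (fun b x => jumpProc R.m (max (t k - b) 0) x) u ω) := by
    intro ω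
    rw [← Finset.mul_sum, Finset.sum_sub_distrib]
    by_cases hω : ω ∈ A
    · rw [hΦ, Set.indicator_of_mem hω, Set.indicator_of_mem hω]
      rfl
    · rw [hΦ, Set.indicator_of_notMem hω, Set.indicator_of_notMem hω, zero_mul]
  simp_rw [e1]
  have hi (u : Label R) : Integrable (fun ω => Φ ω *
        (ballInc R root (fun b x => jumpProc R.m (max (t N - b) 0) x) u ω -
          ballInc R root (fun b x => jumpProc R.m (max (t k - b) 0) x) u ω)) (clockLaw R) :=
    hΦL.integrable_mul ((hbL (t N) u).sub (hbL (t k) u))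
  rw [integral_finsetSum _ fun u _ => hi u]
  refine Finset.sum_eq_zero fun u hu => ?_
  rw [integral_clockLaw_eq_update R u (hi u)]
  refine integral_eq_zero_of_ae (.of_forall fun ω => ?_)
  simp only [ballInc_update, Pi.zero_apply]
  set s := max (t k - birthTime ω u) 0 with hs
  have hT : s ≤ max (t N - birthTime ω u) 0 := max_le_max_right _ (by linarith [ht hk])
  -- When the clock of `u` exceeds `s`, its age at time `t k`, `Φ` no longer depends on it. The
  -- value at the clock `s + 1` serves as the constant.
  have h0 := integral_mul_jumpProc_sub (m := R.m) (le_max_right _ _) hT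
      (φ := fun x => Φ (Function.update ω u x)) (κ := Φ (Function.update ω u (s + 1)))
      (fun x hx => hΦeq _ _ fun j hj => genAt_update_eq hu ω (ht hj) hx (lt_add_one s))
  have h1 := congrArg (Real.exp (-(R.m : ℝ) * birthTime ω u) *
    colorVal R (ballColor R root u) * ·) h0
  simp only [mul_zero] at h1
  rw [← integral_const_mul] at h1
  refine Eq.trans ?_ h1
  congr 1
  ext x
  ring

/-! ### Non-explosion -/

lemma ratio_pos (hm : (0 : ℝ) ≤ R.m) : 0 < ratio R := by unfold ratio; positivity

/-- The sum of `exp (-2 m b)` over the birth times `b` in the whole tree has finite expectation, a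
geometric series of ratio `ratio R`. Almost surely its generation sums tend to `0`, which pushes all
birth times of late generations beyond `t`. -/
lemma ae_birthTime_gt (hm : (0 : ℝ) ≤ R.m) (hρ : ratio R < 1) :
    ∀ᵐ ω ∂(clockLaw R), ∀ t : ℝ, ∃ N, ∀ u : Label R, N ≤ u.length → t < birthTime ω u := by
  set f : ℕ → Clocks R → ℝ := fun n ω =>
    ∑ u ∈ gen R n, Real.exp (-(2 * (R.m : ℝ)) * birthTime ω u) with hf
  have hfm : ∀ n, Measurable (f n) := fun n => by
    rw [hf]
    exact Finset.measurable_fun_sum _ fun u _ => by fun_prop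
  have hf0 : ∀ n ω, 0 ≤ f n ω := fun n ω => Finset.sum_nonneg fun _ _ => (Real.exp_pos _).le
  have h1 : ∫⁻ ω, ∑' n, ENNReal.ofReal (f n ω) ∂(clockLaw R) ≠ ⊤ := by
    rw [lintegral_tsum fun n => (hfm n).ennreal_ofReal.aemeasurable]
    have h2 : ∀ n, ∫⁻ ω, ENNReal.ofReal (f n ω) ∂(clockLaw R) = ENNReal.ofReal (ratio R ^ n) := by
      intro n
      rw [← ofReal_integral_eq_lintegral_ofReal
        (integrable_finsetSum _ fun u _ => integrable_exp_birthTime hm u)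
        (.of_forall (hf0 n)), integral_finsetSum _ fun u _ => integrable_exp_birthTime hm u,
        sum_integral_exp_birthTime hm]
    simp_rw [h2]
    rw [← ENNReal.ofReal_tsum_of_nonneg (fun n => pow_nonneg (ratio_pos hm).le n)
      (summable_geometric_of_lt_one (ratio_pos hm).le hρ)]
    exact ENNReal.ofReal_ne_top
  have h3 := ae_lt_top (Measurable.tsum fun n => (hfm n).ennreal_ofReal) h1
  filter_upwards [h3] with ω hω t
  have h4 : Tendsto (fun n => ENNReal.ofReal (f n ω)) atTop (𝓝 0) :=
    ENNReal.tendsto_atTop_zero_of_tsum_ne_top hω.ne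
  have h5 := h4.eventually_lt_const
    (ENNReal.ofReal_pos.2 (Real.exp_pos (-(2 * (R.m : ℝ)) * t)))
  obtain ⟨N, hN⟩ := eventually_atTop.1 h5
  refine ⟨N, fun u hu => ?_⟩
  have h6 := (ENNReal.ofReal_lt_ofReal_iff (Real.exp_pos _)).1 (hN u.length hu)
  have h7 : Real.exp (-(2 * (R.m : ℝ)) * birthTime ω u) ≤ f u.length ω :=
    Finset.single_le_sum (f := fun u => Real.exp (-(2 * (R.m : ℝ)) * birthTime ω u))
      (fun _ _ => (Real.exp_pos _).le) (mem_gen.2 rfl)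
  have h8 := Real.exp_lt_exp.1 (h7.trans_lt h6)
  by_contra! h
  nlinarith

lemma ae_ballsAt_finite (hm : (0 : ℝ) ≤ R.m) (hρ : ratio R < 1) :
    ∀ᵐ ω ∂(clockLaw R), ∀ t : ℝ, (ballsAt ω t).Finite := by
  filter_upwards [ae_birthTime_gt hm hρ] with ω hω t
  obtain ⟨N, hN⟩ := hω t
  refine (List.finite_length_lt (Fin (R.S + 1)) N).subset fun u hu => ?_
  by_contra h
  exact absurd hu.1 (not_le.2 (hN u (not_lt.1 h)))

/-! ### Uniform control over all times -/

lemma continuousWithinAt_genAt (n : ℕ) (ω : Clocks R) (t : ℝ) :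
    ContinuousWithinAt (fun t => genAt R root n t ω) (Set.Ici t) t := by
  unfold genAt genInc ballInc
  refine tendsto_finsetSum _ fun u _ => ?_
  refine ContinuousWithinAt.mul continuousWithinAt_const ?_
  refine ContinuousWithinAt.comp (f := fun t => max (t - birthTime ω u) 0)
    (continuousWithinAt_jumpProc R.m _ (ω u)) (by fun_prop) fun y hy => ?_
  exact max_le_max_right _ (sub_le_sub_right (Set.mem_Ici.1 hy) _)

/-- Right continuity reduces the supremum over all times to dyadic times, to which the discrete
maximal inequality applies. -/
lemma exists_dyadic_of_lt_abs_genAt {n : ℕ} {ω : Clocks R} {ε t : ℝ} (ht : 0 ≤ t)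
    (h : ε < |genAt R root n t ω|) :
    ∃ j k : ℕ, k ≤ 4 ^ j ∧ ε ≤ |genAt R root n (k / 2 ^ j) ω| := by
  have h1 : ∀ᶠ s in 𝓝[≥] t, ε < |genAt R root n s ω| :=
    (continuousWithinAt_genAt n ω t).abs.eventually_const_lt h
  obtain ⟨δ, hδ, hδ'⟩ := (mem_nhdsGE_iff_exists_Ico_subset).1 h1
  have hδt : 0 < δ - t := sub_pos.2 hδ
  -- With `2 ^ j > t + 1` the next dyadic point has index at most `4 ^ j`; with `2 ^ j > 1 / (δ -
  -- t)` it falls before `δ`.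
  obtain ⟨j, hj⟩ := ((tendsto_pow_atTop_atTop_of_one_lt (one_lt_two (α := ℝ))).eventually_gt_atTop
    (max (t + 1) (1 / (δ - t)))).exists
  have hj1 : t + 1 < 2 ^ j := (le_max_left _ _).trans_lt hj
  have hj2 : 1 < (δ - t) * 2 ^ j := by
    have := (le_max_right _ _).trans_lt hj
    rwa [div_lt_iff₀' hδt] at this
  have hp : (1 : ℝ) ≤ 2 ^ j := by linarith
  have hp0 : (0 : ℝ) < 2 ^ j := by linarith
  have hlt := Nat.lt_floor_add_one (t * 2 ^ j)
  have hle := Nat.floor_le (mul_nonneg ht hp0.le)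
  refine ⟨j, ⌊t * 2 ^ j⌋₊ + 1, ?_, (hδ' ⟨?_, ?_⟩).le⟩
  · have : ((⌊t * 2 ^ j⌋₊ + 1 : ℕ) : ℝ) ≤ ((4 ^ j : ℕ) : ℝ) := by
      push_cast
      rw [show (4 : ℝ) = 2 * 2 by norm_num, mul_pow]
      nlinarith
    exact_mod_cast this
  · rw [le_div_iff₀ hp0]
    push_cast
    exact hlt.le
  · rw [div_lt_iff₀ hp0]
    push_cast
    linarith

lemma measure_exists_genAt_le (hm : (0 : ℝ) ≤ R.m) (n : ℕ) {ε : ℝ} (hε : 0 < ε) :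
    clockLaw R {ω | ∃ t, 0 ≤ t ∧ ε < |genAt R root n t ω|} ≤
      ENNReal.ofReal ((colorBound R * (R.m + 2)) ^ 2 * ratio R ^ n / ε ^ 2) := by
  set E : ℕ → Set (Clocks R) := fun j =>
    {ω | ∃ k ≤ 4 ^ j, ε ≤ |genAt R root n ((k : ℕ) / 2 ^ j) ω|} with hE
  -- The grid of mesh `2⁻ʲ` on `[0, 2 ^ j]` is contained in the next one, so the bound passes to the
  -- union by continuity from below.
  have hmono : Monotone E := by
    refine monotone_nat_of_le_succ fun j ω hω => ?_
    obtain ⟨k, hk, hk'⟩ := hω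
    refine ⟨2 * k, ?_, ?_⟩
    · rw [pow_succ]
      omega
    · rwa [show ((2 * k : ℕ) : ℝ) / 2 ^ (j + 1) = (k : ℝ) / 2 ^ j by
        push_cast
        rw [pow_succ]
        field_simp]
  have hsub : {ω | ∃ t, 0 ≤ t ∧ ε < |genAt R root n t ω|} ⊆ ⋃ j, E j := by
    rintro ω ⟨t, ht, h⟩
    obtain ⟨j, k, hk, hk'⟩ := exists_dyadic_of_lt_abs_genAt ht h
    exact Set.mem_iUnion.2 ⟨j, k, hk, hk'⟩
  refine (measure_mono hsub).trans ?_
  rw [hmono.measure_iUnion]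
  refine iSup_le fun j => ?_
  rw [← ofReal_measureReal]
  refine ENNReal.ofReal_le_ofReal ?_
  rw [le_div_iff₀' (by positivity)]
  exact measureReal_exists_genAt_le hm n (t := fun k => (k : ℝ) / 2 ^ j)
    (fun a b hab => by dsimp only; gcongr) hε.le (4 ^ j)

/-- The geometric rate at which the contributions of the generations decrease. -/
def rate (R : ReplacementMatrix) : ℝ := √(√(ratio R))

lemma rate_nonneg : 0 ≤ rate R := Real.sqrt_nonneg _

lemma rate_pos (hm : (0 : ℝ) ≤ R.m) : 0 < rate R :=
  Real.sqrt_pos.2 (Real.sqrt_pos.2 (ratio_pos hm))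

lemma rate_lt_one (hρ : ratio R < 1) : rate R < 1 := by
  rw [rate, Real.sqrt_lt' one_pos, one_pow, Real.sqrt_lt' one_pos, one_pow]
  exact hρ

lemma rate_sq : rate R ^ 2 = √(ratio R) := Real.sq_sqrt (Real.sqrt_nonneg _)

lemma ratio_div_rate_sq : ratio R / rate R ^ 2 = rate R ^ 2 := by
  rw [rate_sq, Real.div_sqrt]

/-- Borel–Cantelli. Since `rate` is the fourth root of `ratio`, exceeding the level `rate ^ n` has
probability of order `ratio ^ n / rate ^ (2 n) = rate ^ (2 n)`, which is summable. -/
lemma ae_eventually_genAt_le (hm : (0 : ℝ) ≤ R.m) (hρ : ratio R < 1) (root : Color) :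
    ∀ᵐ ω ∂(clockLaw R), ∀ᶠ n in atTop, ∀ t, 0 ≤ t → |genAt R root n t ω| ≤ rate R ^ n := by
  have hs : ∑' n, clockLaw R {ω | ∃ t, 0 ≤ t ∧ rate R ^ n < |genAt R root n t ω|} ≠ ⊤ := by
    have hle : ∀ n, clockLaw R {ω | ∃ t, 0 ≤ t ∧ rate R ^ n < |genAt R root n t ω|} ≤
        ENNReal.ofReal ((colorBound R * (R.m + 2)) ^ 2 * (rate R ^ 2) ^ n) := by
      intro n
      refine (measure_exists_genAt_le hm n (pow_pos (rate_pos hm) n)).trans (le_of_eq ?_)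
      rw [mul_div_assoc, ← pow_mul, mul_comm n 2, pow_mul, ← div_pow, ratio_div_rate_sq]
    refine ne_top_of_le_ne_top ?_ (ENNReal.tsum_le_tsum hle)
    rw [← ENNReal.ofReal_tsum_of_nonneg (fun n => by have := rate_nonneg (R := R); positivity)]
    · exact ENNReal.ofReal_ne_top
    · refine (summable_geometric_of_lt_one (by have := rate_nonneg (R := R); positivity) ?_).mul_left _
      exact pow_lt_one₀ rate_nonneg (rate_lt_one hρ) two_ne_zero
  filter_upwards [ae_eventually_notMem hs] with ω hω
  filter_upwards [hω] with n hn t ht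
  by_contra h
  exact hn ⟨t, ht, not_le.1 h⟩

/-! ### The decomposition of the urn along the generations -/

/-- The martingale indexed by the generations. -/
def genMart (R : ReplacementMatrix) (root : Color) (n : ℕ) (ω : Clocks R) : ℝ :=
  ∑ u ∈ gen R n, Real.exp (-(R.m : ℝ) * birthTime ω u) * colorVal R (ballColor R root u)

lemma genMart_zero (ω : Clocks R) : genMart R root 0 ω = colorVal R root := by
  simp [genMart, ballColor]

lemma genMart_succ (hbal : R.Balanced) (n : ℕ) (ω : Clocks R) :
    genMart R root (n + 1) ω = genMart R root n ω + genLim R root n ω := by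
  unfold genMart genLim genInc ballInc
  rw [sum_gen_succ, ← Finset.sum_add_distrib]
  refine Finset.sum_congr rfl fun u _ => ?_
  simp_rw [birthTime_append, ballColor_append]
  rw [← Finset.mul_sum, sum_colorVal_childColor hbal, mul_add, Real.exp_add]
  ring

lemma genMart_eq_sum (hbal : R.Balanced) (n : ℕ) (ω : Clocks R) :
    genMart R root n ω = colorVal R root + ∑ k ∈ Finset.range n, genLim R root k ω := by
  induction n with
  | zero => simp [genMart_zero]
  | succ n ih => rw [genMart_succ hbal, ih, Finset.sum_range_succ, add_assoc]

lemma tendsto_genAt (n : ℕ) (ω : Clocks R) :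
    Tendsto (fun t => genAt R root n t ω) atTop (𝓝 (genLim R root n ω)) := by
  unfold genAt genLim genInc ballInc
  refine tendsto_finsetSum _ fun u _ => Tendsto.const_mul _ ?_
  refine tendsto_const_nhds.congr' ?_
  filter_upwards [eventually_ge_atTop (birthTime ω u + ω u)] with t ht
  rw [jumpProc_of_le (le_max_of_le_left (by linarith))]

/-- The part of the urn at time `t` that comes from the balls of the `n`-th generation. -/
def aliveAt (R : ReplacementMatrix) (root : Color) (n : ℕ) (t : ℝ) (ω : Clocks R) : ℝ :=
  ∑ u ∈ gen R n, if birthTime ω u ≤ t ∧ t < birthTime ω u + ω u then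
    Real.exp (-(R.m : ℝ) * t) * colorVal R (ballColor R root u) else 0

/-- The part of the `n`-th term of the martingale that comes from the balls born before `t`. -/
def bornAt (R : ReplacementMatrix) (root : Color) (n : ℕ) (t : ℝ) (ω : Clocks R) : ℝ :=
  ∑ u ∈ gen R n, if birthTime ω u ≤ t then
    Real.exp (-(R.m : ℝ) * birthTime ω u) * colorVal R (ballColor R root u) else 0

/-- Conservation, ball by ball: a ball unborn at `t` contributes nothing, a living one is counted in
`aliveAt`, and a dead one has been replaced by its children in `bornAt (n + 1)`. In each case
`genAt` records the change of value. -/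
lemma bornAt_succ_add_aliveAt (hbal : R.Balanced) {ω : Clocks R} (hω : ∀ u, 0 < ω u) (n : ℕ)
    (t : ℝ) : bornAt R root (n + 1) t ω + aliveAt R root n t ω =
      bornAt R root n t ω + genAt R root n t ω := by
  unfold bornAt aliveAt genAt genInc ballInc
  rw [sum_gen_succ, ← Finset.sum_add_distrib, ← Finset.sum_add_distrib]
  refine Finset.sum_congr rfl fun u _ => ?_
  have h := hω u
  simp_rw [birthTime_append, ballColor_append]
  rcases lt_or_ge t (birthTime ω u) with h1 | h1
  · rw [max_eq_right (by linarith), jumpProc_of_lt h, if_neg (by intro h; linarith [h.1]),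
      if_neg (by linarith)]
    simp only [if_neg (show ¬ birthTime ω u + ω u ≤ t by linarith)]
    simp
  · rw [max_eq_left (by linarith), if_pos h1]
    rcases lt_or_ge t (birthTime ω u + ω u) with h2 | h2
    · rw [jumpProc_of_lt (by linarith), if_pos ⟨h1, h2⟩]
      simp only [if_neg (show ¬ birthTime ω u + ω u ≤ t by linarith)]
      rw [show -(R.m : ℝ) * t = -(R.m : ℝ) * birthTime ω u + -(R.m : ℝ) * (t - birthTime ω u) by
        ring, Real.exp_add]
      simp
      ring
    · rw [jumpProc_of_le (by linarith), if_neg (by intro h; linarith [h.2])]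
      simp only [if_pos h2]
      rw [← Finset.mul_sum, sum_colorVal_childColor hbal, mul_add, Real.exp_add]
      ring

lemma sum_aliveAt (hbal : R.Balanced) {ω : Clocks R} (hω : ∀ u, 0 < ω u) {t : ℝ}
    (ht : 0 ≤ t) (n : ℕ) : bornAt R root n t ω + ∑ k ∈ Finset.range n, aliveAt R root k t ω =
      colorVal R root + ∑ k ∈ Finset.range n, genAt R root k t ω := by
  induction n with
  | zero => simp [bornAt, ballColor, ht]
  | succ n ih =>
    rw [Finset.sum_range_succ, Finset.sum_range_succ]
    linarith [bornAt_succ_add_aliveAt (root := root) hbal hω n t]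

lemma normalizedProj_eq_sum_aliveAt {ω : Clocks R} {t : ℝ} {N : ℕ}
    (hN : ∀ u : Label R, N ≤ u.length → t < birthTime ω u) :
    normalizedProj R root t ω = ∑ k ∈ Finset.range N, aliveAt R root k t ω := by
  classical
  let F : Finset (Label R) := (Finset.range N).biUnion fun n => gen R n
  have hF : ∀ u, u ∈ F ↔ u.length < N := by simp [F]
  have hc : ∀ κ : Color, {u ∈ ballsAt ω t | ballColor R root u = κ}.ncard =
      (F.filter fun u => (birthTime ω u ≤ t ∧ t < birthTime ω u + ω u) ∧
        ballColor R root u = κ).card := by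
    intro κ
    rw [← Set.ncard_coe_finset]
    congr 1
    ext u
    simp only [ballsAt, Finset.coe_filter, hF]
    constructor
    · rintro ⟨h1, h2⟩
      exact ⟨by by_contra h; exact absurd h1.1 (not_le.2 (hN u (not_lt.1 h))), h1, h2⟩
    · rintro ⟨_, h1, h2⟩
      exact ⟨h1, h2⟩
  have hsum : ∑ k ∈ Finset.range N, aliveAt R root k t ω =
      ∑ u ∈ F, if birthTime ω u ≤ t ∧ t < birthTime ω u + ω u then
        Real.exp (-(R.m : ℝ) * t) * colorVal R (ballColor R root u) else 0 := by
    unfold aliveAt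
    rw [Finset.sum_biUnion]
    intro i _ j _ hij
    refine Finset.disjoint_left.2 fun u hu hu' => hij ?_
    rw [← mem_gen.1 hu, mem_gen.1 hu']
  have hterm : ∀ u, (if birthTime ω u ≤ t ∧ t < birthTime ω u + ω u then
        Real.exp (-(R.m : ℝ) * t) * colorVal R (ballColor R root u) else 0) =
      Real.exp (-(R.m : ℝ) * t) * (colorVal R .red *
        (if (birthTime ω u ≤ t ∧ t < birthTime ω u + ω u) ∧
          ballColor R root u = .red then 1 else 0) + colorVal R .black *
        (if (birthTime ω u ≤ t ∧ t < birthTime ω u + ω u) ∧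
          ballColor R root u = .black then 1 else 0)) := by
    intro u
    by_cases h : birthTime ω u ≤ t ∧ t < birthTime ω u + ω u
    · cases hb : ballColor R root u <;> simp [h]
    · simp [h]
  rw [hsum, normalizedProj, u2, compositionAt, hc, hc, Finset.sum_congr rfl fun u _ => hterm u,
    ← Finset.mul_sum, Finset.sum_add_distrib, ← Finset.mul_sum, ← Finset.mul_sum,
    Finset.sum_boole, Finset.sum_boole]
  simp only [colorVal]
  ring

lemma normalizedProj_eq_tsum (hbal : R.Balanced) {ω : Clocks R} (hω : ∀ u, 0 < ω u) {t : ℝ}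
    (ht : 0 ≤ t) {N : ℕ} (hN : ∀ u : Label R, N ≤ u.length → t < birthTime ω u) :
    normalizedProj R root t ω = colorVal R root + ∑' n, genAt R root n t ω := by
  have hborn : bornAt R root N t ω = 0 := Finset.sum_eq_zero fun u hu =>
    if_neg (not_le.2 (hN u (mem_gen.1 hu).ge))
  rw [normalizedProj_eq_sum_aliveAt hN, ← zero_add (∑ k ∈ _, _), ← hborn,
    sum_aliveAt hbal hω ht, tsum_eq_sum fun n hn => ?_]
  unfold genAt genInc ballInc
  refine Finset.sum_eq_zero fun u hu => ?_
  have := hN u (by rw [mem_gen.1 hu]; simpa using hn)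
  beta_reduce
  -- No ball of this generation is born by time `t`: the truncated age is `0` and `exp 0 - 1 = 0`.
  rw [max_eq_right (by linarith), jumpProc_of_lt (hω u)]
  simp

/-! ### Almost sure convergence -/

lemma ae_exists_limit (hbal : R.Balanced) (hm : (0 : ℝ) ≤ R.m) (hρ : ratio R < 1)
    (root : Color) : ∀ᵐ ω ∂(clockLaw R),
      Summable (fun n => genLim R root n ω) ∧
      Tendsto (fun t => normalizedProj R root t ω) atTop
        (𝓝 (colorVal R root + ∑' n, genLim R root n ω)) := by
  filter_upwards [ae_clocks_pos R, ae_birthTime_gt hm hρ, ae_eventually_genAt_le hm hρ root]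
    with ω hω hb hg
  obtain ⟨N, hN⟩ := eventually_atTop.1 hg
  -- A dominating sequence uniform in `t`: crude deterministic bounds for the finitely many early
  -- generations, the geometric bound afterwards.
  set B : ℕ → ℝ := fun n => if n < N then ∑ _u ∈ gen R n, colorBound R * (R.m + 2) else rate R ^ n
  have hBs : Summable B := by
    refine (summable_geometric_of_lt_one rate_nonneg (rate_lt_one hρ)).congr_atTop ?_
    filter_upwards [eventually_ge_atTop N] with n hn
    simp [B, not_lt.2 hn]
  have hB : ∀ n t, 0 ≤ t → |genAt R root n t ω| ≤ B n := by
    intro n t ht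
    by_cases hn : n < N
    · simp only [B, if_pos hn]
      refine (Finset.abs_sum_le_sum_abs _ _).trans (Finset.sum_le_sum fun u _ => ?_)
      exact abs_ballInc_le' hm (centred_jumpProc hm).abs_le hω u
    · simp only [B, if_neg hn]
      exact hN n (not_lt.1 hn) t ht
  have hlim : ∀ n, |genLim R root n ω| ≤ B n := fun n =>
    le_of_tendsto (tendsto_genAt n ω).abs
      (by filter_upwards [eventually_ge_atTop 0] with t ht using hB n t ht)
  refine ⟨Summable.of_norm_bounded hBs hlim, ?_⟩
  have h1 := tendsto_tsum_of_dominated_convergence hBs (fun n => tendsto_genAt (root := root) n ω)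
    (by filter_upwards [eventually_ge_atTop 0] with t ht n using hB n t ht)
  refine (h1.const_add (colorVal R root)).congr' ?_
  filter_upwards [eventually_ge_atTop 0] with t ht
  obtain ⟨M, hM⟩ := hb t
  exact (normalizedProj_eq_tsum hbal hω ht hM).symm

lemma ae_limitW_eq (hbal : R.Balanced) (hm : (0 : ℝ) ≤ R.m) (hρ : ratio R < 1) (root : Color) :
    ∀ᵐ ω ∂(clockLaw R), limitW R root ω = colorVal R root + ∑' n, genLim R root n ω := by
  filter_upwards [ae_exists_limit hbal hm hρ root] with ω hω using hω.2.limUnder_eq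

lemma ae_tendsto_normalizedProj (hbal : R.Balanced) (hm : (0 : ℝ) ≤ R.m) (hρ : ratio R < 1)
    (root : Color) : ∀ᵐ ω ∂(clockLaw R),
      Tendsto (fun t => normalizedProj R root t ω) atTop (𝓝 (limitW R root ω)) := by
  filter_upwards [ae_exists_limit hbal hm hρ root, ae_limitW_eq hbal hm hρ root] with ω h1 h2
  rw [h2]
  exact h1.2

/-! ### Second moments of the limit -/

lemma ratio_pow_eq (hm : (0 : ℝ) ≤ R.m) (n : ℕ) :
    ratio R ^ n = (rate R ^ 2) ^ n * (rate R ^ 2) ^ n := by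
  rw [rate_sq, ← mul_pow, Real.mul_self_sqrt (ratio_pos hm).le]

lemma summable_rate_sq (hρ : ratio R < 1) : Summable fun n => (rate R ^ 2) ^ n :=
  summable_geometric_of_lt_one (sq_nonneg _) (pow_lt_one₀ rate_nonneg (rate_lt_one hρ) two_ne_zero)

lemma memLp_genLim (hm : (0 : ℝ) ≤ R.m) (n : ℕ) : MemLp (genLim R root n) 2 (clockLaw R) :=
  memLp_genInc hm (centred_limit hm) n

lemma integral_genLim_sq_le (hm : (0 : ℝ) ≤ R.m) (n : ℕ) :
    ∫ ω, genLim R root n ω ^ 2 ∂(clockLaw R) ≤ (colorBound R * (R.m + 2)) ^ 2 * ratio R ^ n :=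
  integral_genInc_sq_le hm (centred_limit hm) n

lemma integral_norm_genLim_le (hm : (0 : ℝ) ≤ R.m) (n : ℕ) :
    ∫ ω, ‖genLim R root n ω‖ ∂(clockLaw R) ≤
      ((colorBound R * (R.m + 2)) ^ 2 + 1) * (rate R ^ 2) ^ n := by
  have hq : 0 < (rate R ^ 2) ^ n := by have := rate_pos hm; positivity
  set q := (rate R ^ 2) ^ n
  have hL := memLp_genLim (root := root) hm n
  -- Use `|y| ≤ y ^ 2 / q + q` with `q = √ratio ^ n`, which balances the two terms because the
  -- second moment is `O(q ^ 2)`.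
  have h1 : ∫ ω, ‖genLim R root n ω‖ ∂(clockLaw R) ≤
      ∫ ω, (q⁻¹ * genLim R root n ω ^ 2 + q) ∂(clockLaw R) := by
    refine integral_mono (hL.integrable one_le_two).norm
      ((hL.integrable_sq.const_mul _).add (integrable_const _)) fun ω => ?_
    simp only [Real.norm_eq_abs]
    rw [← sq_abs]
    set y := |genLim R root n ω|
    have h2 : q⁻¹ * y ^ 2 + q - y = q⁻¹ * ((y - q / 2) ^ 2 + 3 / 4 * q ^ 2) := by
      field_simp
      ring
    have h3 : 0 ≤ q⁻¹ * ((y - q / 2) ^ 2 + 3 / 4 * q ^ 2) := by positivity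
    linarith
  rw [integral_add (hL.integrable_sq.const_mul _) (integrable_const _), integral_const_mul] at h1
  refine h1.trans ?_
  have h4 := mul_le_mul_of_nonneg_left (integral_genLim_sq_le (root := root) hm n)
    (inv_nonneg.2 hq.le)
  rw [ratio_pow_eq hm] at h4
  have h5 : q⁻¹ * ((colorBound R * (R.m + 2)) ^ 2 * (q * q)) =
      (colorBound R * (R.m + 2)) ^ 2 * q := by
    field_simp
  simp only [integral_const, probReal_univ, smul_eq_mul, one_mul]
  change _ ≤ q⁻¹ * ((colorBound R * (R.m + 2)) ^ 2 * (q * q)) at h4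
  linarith

lemma eLpNorm_two_le_ofReal_sqrt {Ω : Type*} [MeasurableSpace Ω] {P : Measure Ω} {f : Ω → ℝ}
    (hf : MemLp f 2 P) {c : ℝ} (hc : ∫ ω, f ω ^ 2 ∂P ≤ c) :
    eLpNorm f 2 P ≤ ENNReal.ofReal (√c) := by
  rw [hf.eLpNorm_eq_integral_rpow_norm two_ne_zero ENNReal.ofNat_ne_top]
  refine ENNReal.ofReal_le_ofReal ?_
  rw [Real.sqrt_eq_rpow]
  simp only [ENNReal.toReal_ofNat, Real.rpow_two, Real.norm_eq_abs, sq_abs, one_div]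
  exact Real.rpow_le_rpow (integral_nonneg fun _ => sq_nonneg _) hc (by norm_num)

lemma eLpNorm_genLim_le (hm : (0 : ℝ) ≤ R.m) (n : ℕ) :
    eLpNorm (genLim R root n) 2 (clockLaw R) ≤
      ENNReal.ofReal (colorBound R * (R.m + 2) * (rate R ^ 2) ^ n) := by
  refine (eLpNorm_two_le_ofReal_sqrt (memLp_genLim hm n) (integral_genLim_sq_le hm n)).trans
    (le_of_eq ?_)
  rw [ratio_pow_eq hm, ← pow_two, ← mul_pow, Real.sqrt_sq]
  have := colorBound_nonneg (R := R)
  positivity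

/-- A measurable version of the limit. -/
def treeLim (R : ReplacementMatrix) (root : Color) (ω : Clocks R) : ℝ :=
  colorVal R root + ∑' n, genLim R root n ω

lemma measurable_genLim (hm : (0 : ℝ) ≤ R.m) (n : ℕ) : Measurable (genLim R root n) :=
  measurable_genInc (centred_limit hm).measurable n

lemma measurable_treeLim (hm : (0 : ℝ) ≤ R.m) : Measurable (treeLim R root) :=
  (Measurable.tsum fun n => measurable_genLim hm n).const_add _

lemma ae_limitW_eq_treeLim (hbal : R.Balanced) (hm : (0 : ℝ) ≤ R.m) (hρ : ratio R < 1)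
    (root : Color) : limitW R root =ᵐ[clockLaw R] treeLim R root :=
  ae_limitW_eq hbal hm hρ root

lemma ae_tendsto_genMart_treeLim (hbal : R.Balanced) (hm : (0 : ℝ) ≤ R.m) (hρ : ratio R < 1)
    (root : Color) : ∀ᵐ ω ∂(clockLaw R),
      Tendsto (fun n => genMart R root n ω) atTop (𝓝 (treeLim R root ω)) := by
  filter_upwards [ae_exists_limit hbal hm hρ root] with ω h1
  simp_rw [genMart_eq_sum hbal]
  exact h1.1.hasSum.tendsto_sum_nat.const_add _

/-- The `L²` norms of the increments are summable, so `genMart` is bounded in `L²`. Fatou's lemma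
passes the bound to the almost sure limit. -/
lemma memLp_treeLim (hbal : R.Balanced) (hm : (0 : ℝ) ≤ R.m) (hρ : ratio R < 1) :
    MemLp (treeLim R root) 2 (clockLaw R) := by
  refine ⟨(measurable_treeLim hm).aestronglyMeasurable, ?_⟩
  have heq : ∀ n, genMart R root n =
      (fun _ => colorVal R root) + ∑ k ∈ Finset.range n, genLim R root k := fun n => by
    ext ω
    simp [genMart_eq_sum hbal]
  have hmeas : ∀ n, AEStronglyMeasurable (genMart R root n) (clockLaw R) := fun n => by
    rw [heq]
    exact aestronglyMeasurable_const.add (Finset.aestronglyMeasurable_sum _ fun k _ =>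
      (measurable_genLim hm k).aestronglyMeasurable)
  have hC : 0 ≤ colorBound R * (R.m + 2) := by
    have := colorBound_nonneg (R := R)
    positivity
  have hbd : ∀ n, eLpNorm (genMart R root n) 2 (clockLaw R) ≤
      eLpNorm (fun _ : Clocks R => colorVal R root) 2 (clockLaw R) +
        ENNReal.ofReal (∑' k, colorBound R * (R.m + 2) * (rate R ^ 2) ^ k) := by
    intro n
    rw [heq]
    refine (eLpNorm_add_le aestronglyMeasurable_const (Finset.aestronglyMeasurable_sum _
      fun k _ => (measurable_genLim hm k).aestronglyMeasurable) one_le_two).trans ?_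
    gcongr
    refine (eLpNorm_sum_le (fun k _ => (measurable_genLim hm k).aestronglyMeasurable)
      one_le_two).trans ((Finset.sum_le_sum fun k _ => eLpNorm_genLim_le hm k).trans ?_)
    rw [ENNReal.ofReal_tsum_of_nonneg (fun k => mul_nonneg hC (by positivity))
      ((summable_rate_sq hρ).mul_left _)]
    exact ENNReal.sum_le_tsum _
  refine (Lp.eLpNorm_lim_le_liminf_eLpNorm hmeas _
    (ae_tendsto_genMart_treeLim hbal hm hρ root)).trans_lt ?_
  refine lt_of_le_of_lt (liminf_le_of_le (a := _) (h := fun b hb => ?_)) (ENNReal.add_lt_top.2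
    ⟨(memLp_const (p := 2) (μ := clockLaw R) (colorVal R root)).2,
      ENNReal.ofReal_lt_top (r := ∑' k, colorBound R * (R.m + 2) * (rate R ^ 2) ^ k)⟩)
  obtain ⟨n, hn⟩ := hb.exists
  exact hn.trans (hbd n)

lemma integral_treeLim (hbal : R.Balanced) (hm : (0 : ℝ) ≤ R.m) (hρ : ratio R < 1) :
    ∫ ω, treeLim R root ω ∂(clockLaw R) = colorVal R root := by
  have hi : ∀ n, Integrable (genLim R root n) (clockLaw R) := fun n =>
    (memLp_genLim hm n).integrable one_le_two
  have hs : Summable fun n => ∫ ω, ‖genLim R root n ω‖ ∂(clockLaw R) :=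
    Summable.of_nonneg_of_le (fun n => integral_nonneg fun _ => norm_nonneg _)
      (fun n => integral_norm_genLim_le hm n) ((summable_rate_sq hρ).mul_left _)
  have h1 := hasSum_integral_of_summable_integral_norm hi hs
  have h0 : ∀ n, ∫ ω, genLim R root n ω ∂(clockLaw R) = 0 := fun n =>
    integral_genInc hm (centred_limit hm) n
  simp_rw [h0] at h1
  have h2 := h1.unique hasSum_zero
  have h3 : Integrable (fun ω => ∑' n, genLim R root n ω) (clockLaw R) := by
    have h4 := ((memLp_treeLim (root := root) hbal hm hρ).integrable one_le_two).sub
      (integrable_const (colorVal R root))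
    refine h4.congr (.of_forall fun ω => ?_)
    simp [treeLim]
  unfold treeLim
  rw [integral_add (integrable_const _) h3, h2]
  simp

/-! ### Laws of weighted sums -/

lemma integral_pi_exp_sum {n : ℕ} (μ : Fin n → Measure ℝ) [∀ i, IsProbabilityMeasure (μ i)]
    (s : ℝ) : ∫ x, Complex.exp (((s * ∑ i, x i : ℝ) : ℂ) * Complex.I) ∂(Measure.pi μ) =
      ∏ i, charFun (μ i) s := by
  simp_rw [charFun_apply_real]
  rw [← integral_fintype_prod_eq_prod (𝕜 := ℂ)
    (f := fun _ (x : ℝ) => Complex.exp (s * x * Complex.I))]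
  congr 1
  ext x
  rw [← Complex.exp_sum]
  push_cast
  rw [Finset.mul_sum, Finset.sum_mul]

lemma isProbabilityMeasure_smoothing (m : ℤ) (p q : ℕ) (μ ν : Measure ℝ)
    [IsProbabilityMeasure μ] [IsProbabilityMeasure ν] :
    IsProbabilityMeasure (smoothing m p q μ ν) := by
  have : IsProbabilityMeasure (volume.restrict (Set.Icc (0 : ℝ) 1)) := by
    rw [← map_exp_neg_expMeasure_one]
    exact Measure.isProbabilityMeasure_map (by fun_prop)
  exact Measure.isProbabilityMeasure_map (by fun_prop)

/-- Condition on the uniform variable, written as `exp (-x)` with `x` exponential; independence then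
factorises the characteristic function of the sum. -/
lemma charFun_smoothing (m : ℤ) (p q : ℕ) (μ ν : Measure ℝ)
    [IsProbabilityMeasure μ] [IsProbabilityMeasure ν] (t : ℝ) :
    charFun (smoothing m p q μ ν) t =
      ∫ x, charFun μ (t * Real.exp (-(m : ℝ) * x)) ^ p *
        charFun ν (t * Real.exp (-(m : ℝ) * x)) ^ q ∂(expMeasure 1) := by
  have : IsProbabilityMeasure (volume.restrict (Set.Icc (0 : ℝ) 1)) := by
    rw [← map_exp_neg_expMeasure_one]
    exact Measure.isProbabilityMeasure_map (by fun_prop)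
  have hmeas : Measurable fun z : ℝ × (Fin p → ℝ) × (Fin q → ℝ) =>
      z.1 ^ m * ((∑ k, z.2.1 k) + ∑ k, z.2.2 k) := by fun_prop
  rw [charFun_apply_real, smoothing, integral_map hmeas.aemeasurable (by fun_prop), integral_prod _
    (Integrable.of_bound (by fun_prop) 1 (.of_forall fun z => by
      rw [← Complex.ofReal_mul, Complex.norm_exp_ofReal_mul_I]))]
  have hin : ∀ u : ℝ, ∫ z : (Fin p → ℝ) × (Fin q → ℝ),
      Complex.exp (t * ((u ^ m * ((∑ k, z.1 k) + ∑ k, z.2 k) : ℝ) : ℂ) * Complex.I)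
        ∂((Measure.pi fun _ => μ).prod (Measure.pi fun _ => ν)) =
      charFun μ (t * u ^ m) ^ p * charFun ν (t * u ^ m) ^ q := by
    intro u
    have e1 := integral_pi_exp_sum (fun _ : Fin p => μ) (t * u ^ m)
    have e2 := integral_pi_exp_sum (fun _ : Fin q => ν) (t * u ^ m)
    rw [Finset.prod_const, Finset.card_univ, Fintype.card_fin] at e1 e2
    rw [← e1, ← e2, ← integral_prod_mul]
    congr 1
    ext z
    rw [← Complex.exp_add]
    push_cast
    ring_nf
  simp_rw [hin]
  rw [← map_exp_neg_expMeasure_one, integral_map (by fun_prop)]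
  · congr 1
    ext x
    rw [show -(m : ℝ) * x = (-x) * m by ring, Real.exp_mul, Real.rpow_intCast]
  · refine Measurable.aestronglyMeasurable ?_
    have := measurable_charFun (μ := μ)
    have := measurable_charFun (μ := ν)
    fun_prop

/-! ### Existence of a solution -/

lemma genMart_glue_succ (n : ℕ) (p : ℝ × (Fin (R.S + 1) → Clocks R)) :
    genMart R root (n + 1) (glue p) =
      Real.exp (-(R.m : ℝ) * p.1) * ∑ i, genMart R (childColor R root i) n (p.2 i) := by
  unfold genMart
  rw [sum_gen_succ_cons, Finset.mul_sum]
  refine Finset.sum_congr rfl fun i _ => ?_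
  rw [Finset.mul_sum]
  refine Finset.sum_congr rfl fun u _ => ?_
  rw [birthTime_glue_cons, ballColor_cons, mul_add, Real.exp_add]
  ring

/-- The first-split identity is exact for `genMart` at each finite generation. It survives in the
limit because convergence holds almost surely in the whole tree and in every subtree. -/
lemma ae_treeLim_glue (hbal : R.Balanced) (hm : (0 : ℝ) ≤ R.m) (hρ : ratio R < 1) (root : Color) :
    ∀ᵐ p ∂((expMeasure 1).prod (Measure.pi fun _ : Fin (R.S + 1) => clockLaw R)),
      treeLim R root (glue p) =
        Real.exp (-(R.m : ℝ) * p.1) * ∑ i, treeLim R (childColor R root i) (p.2 i) := by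
  have h1 := measurePreserving_glue.quasiMeasurePreserving.ae
    (ae_tendsto_genMart_treeLim hbal hm hρ root)
  have h2 : ∀ᵐ p ∂((expMeasure 1).prod (Measure.pi fun _ : Fin (R.S + 1) => clockLaw R)),
      ∀ i, Tendsto (fun n => genMart R (childColor R root i) n (p.2 i)) atTop
        (𝓝 (treeLim R (childColor R root i) (p.2 i))) := by
    rw [ae_all_iff]
    intro i
    exact ((measurePreserving_eval (fun _ : Fin (R.S + 1) => clockLaw R)
      i).comp measurePreserving_snd).quasiMeasurePreserving.ae
        (ae_tendsto_genMart_treeLim hbal hm hρ _)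
  filter_upwards [h1, h2] with p hp1 hp2
  refine tendsto_nhds_unique (hp1.comp (tendsto_add_atTop_nat 1)) ?_
  simp only [Function.comp_def, genMart_glue_succ]
  exact (tendsto_finsetSum _ fun i _ => hp2 i).const_mul _

/-- The law of the limit. -/
def treeLaw (R : ReplacementMatrix) (root : Color) : Measure ℝ :=
  (clockLaw R).map (treeLim R root)

lemma isProbabilityMeasure_treeLaw (hm : (0 : ℝ) ≤ R.m) :
    IsProbabilityMeasure (treeLaw R root) :=
  Measure.isProbabilityMeasure_map (measurable_treeLim hm).aemeasurable

lemma treeLaw_mem_M2 (hbal : R.Balanced) (hm : (0 : ℝ) ≤ R.m) (hρ : ratio R < 1) :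
    treeLaw R root ∈ M2 (colorVal R root) := by
  have h := (measurable_treeLim (root := root) hm).aemeasurable (μ := clockLaw R)
  refine ⟨isProbabilityMeasure_treeLaw hm, ?_, ?_⟩
  · exact (memLp_map_measure_iff aestronglyMeasurable_id h).2 (memLp_treeLim hbal hm hρ)
  · rw [treeLaw, integral_map h (f := fun x => x) aestronglyMeasurable_id]
    exact integral_treeLim hbal hm hρ

lemma treeLaw_eq_smoothing (hbal : R.Balanced) (hm : (0 : ℝ) ≤ R.m) (hρ : ratio R < 1)
    (root : Color) : treeLaw R root =
      smoothing R.m (redCount R root) (blackCount R root) (treeLaw R .red) (treeLaw R .black) := by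
  have hP : ∀ κ, IsProbabilityMeasure (treeLaw R κ) := fun κ => isProbabilityMeasure_treeLaw hm
  have := isProbabilityMeasure_smoothing R.m (redCount R root) (blackCount R root)
    (treeLaw R .red) (treeLaw R .black)
  have hW : ∀ κ, Measurable (treeLim R κ) := fun κ => measurable_treeLim hm
  refine Measure.ext_of_charFun (funext fun t => ?_)
  rw [charFun_smoothing]
  have h1 : charFun (treeLaw R root) t =
      ∫ ω, Complex.exp (t * treeLim R root ω * Complex.I) ∂(clockLaw R) := by
    rw [charFun_apply_real, treeLaw, integral_map (hW root).aemeasurable (by fun_prop)]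
  have hglue := measurePreserving_glue (R := R)
  rw [h1, ← hglue.map_eq, integral_map hglue.measurable.aemeasurable (by fun_prop),
    integral_congr_ae (g := fun p => Complex.exp (((t * Real.exp (-(R.m : ℝ) * p.1) *
      ∑ i, treeLim R (childColor R root i) (p.2 i) : ℝ) : ℂ) * Complex.I)) ?_,
    integral_prod _ (Integrable.of_bound (by fun_prop) 1 (.of_forall fun z => by
      rw [Complex.norm_exp_ofReal_mul_I]))]
  · congr 1
    ext x
    dsimp only
    have h2 : Measure.pi (fun i => treeLaw R (childColor R root i)) =
        (Measure.pi fun _ : Fin (R.S + 1) => clockLaw R).map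
          fun η i => treeLim R (childColor R root i) (η i) :=
      (Measure.pi_map_pi fun i => (hW _).aemeasurable).symm
    have h3 := integral_pi_exp_sum (fun i => treeLaw R (childColor R root i))
      (t * Real.exp (-(R.m : ℝ) * x))
    have h4 : Measurable fun (η : Fin (R.S + 1) → Clocks R) (i : Fin (R.S + 1)) =>
        treeLim R (childColor R root i) (η i) :=
      measurable_pi_iff.2 fun i => (hW _).comp (measurable_pi_apply i)
    rw [h2, integral_map h4.aemeasurable (by fun_prop)] at h3
    rw [h3, prod_childColor hbal root fun κ => charFun (treeLaw R κ) _]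
  · filter_upwards [ae_treeLim_glue hbal hm hρ root] with p hp
    simp only [hp]
    push_cast
    ring_nf

lemma isSolution_treeLaw (hbal : R.Balanced) (hm : (0 : ℝ) ≤ R.m) (hρ : ratio R < 1) :
    IsSolution R (treeLaw R .red) (treeLaw R .black) :=
  ⟨treeLaw_eq_smoothing hbal hm hρ .red, treeLaw_eq_smoothing hbal hm hρ .black⟩

/-! ### Scaling of solutions -/

lemma smoothing_map_mul (m : ℤ) (p q : ℕ) (μ ν : Measure ℝ) [IsProbabilityMeasure μ]
    [IsProbabilityMeasure ν] (r : ℝ) :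
    smoothing m p q (μ.map (r * ·)) (ν.map (r * ·)) = (smoothing m p q μ ν).map (r * ·) := by
  have hr : Measurable (r * · : ℝ → ℝ) := by fun_prop
  have := Measure.isProbabilityMeasure_map (μ := μ) hr.aemeasurable
  have := Measure.isProbabilityMeasure_map (μ := ν) hr.aemeasurable
  have := isProbabilityMeasure_smoothing m p q μ ν
  have := isProbabilityMeasure_smoothing m p q (μ.map (r * ·)) (ν.map (r * ·))
  have := Measure.isProbabilityMeasure_map (μ := smoothing m p q μ ν) hr.aemeasurable
  refine Measure.ext_of_charFun (funext fun t => ?_)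
  rw [charFun_map_mul, charFun_smoothing, charFun_smoothing]
  simp_rw [charFun_map_mul, mul_assoc]

lemma IsSolution.map_mul {μ ν : Measure ℝ} [IsProbabilityMeasure μ] [IsProbabilityMeasure ν]
    (h : IsSolution R μ ν) (r : ℝ) : IsSolution R (μ.map (r * ·)) (ν.map (r * ·)) := by
  refine ⟨?_, ?_⟩
  · rw [smoothing_map_mul, ← h.1]
  · rw [smoothing_map_mul, ← h.2]

lemma map_mul_mem_M2 {μ : Measure ℝ} {A : ℝ} (h : μ ∈ M2 A) (r : ℝ) :
    μ.map (r * ·) ∈ M2 (r * A) := by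
  obtain ⟨h1, h2, h3⟩ := h
  have hr : AEMeasurable (r * · : ℝ → ℝ) μ := by fun_prop
  refine ⟨Measure.isProbabilityMeasure_map hr, ?_, ?_⟩
  · exact (memLp_map_measure_iff aestronglyMeasurable_id hr).2 (h2.const_mul r)
  · rw [integral_map hr (f := fun x => x) aestronglyMeasurable_id, integral_const_mul, h3]

/-! ### Uniqueness of the solution -/

lemma norm_exp_mul_I_sub_one_sub_le (y : ℝ) :
    ‖Complex.exp (y * Complex.I) - 1 - y * Complex.I‖ ≤ 3 * y ^ 2 := by
  have hn : ‖(y : ℂ) * Complex.I‖ = |y| := by simp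
  rcases le_or_gt |y| 1 with h | h
  · refine (Complex.norm_exp_sub_one_sub_id_le (by rw [hn]; exact h)).trans ?_
    rw [hn, sq_abs]
    nlinarith [sq_nonneg y]
  · refine (norm_sub_le _ _).trans ((add_le_add_left (norm_sub_le _ _) _).trans ?_)
    rw [Complex.norm_exp_ofReal_mul_I, norm_one, hn, ← sq_abs]
    nlinarith

/-- The first-order expansion depends on the law only through its mean, so two laws in `M2 A` have
characteristic functions at distance `O(t ^ 2)`. -/
lemma norm_charFun_sub_le {μ : Measure ℝ} {A : ℝ} (h : μ ∈ M2 A) (t : ℝ) :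
    ‖charFun μ t - (1 + t * A * Complex.I)‖ ≤ 3 * (∫ x, x ^ 2 ∂μ) * t ^ 2 := by
  obtain ⟨h1, h2, h3⟩ := h
  have hi : Integrable (fun x : ℝ => (x : ℂ)) μ := (h2.integrable one_le_two).ofReal
  have he : Integrable (fun x : ℝ => Complex.exp (t * x * Complex.I)) μ :=
    Integrable.of_bound (by fun_prop) 1 (.of_forall fun x => by
      rw [← Complex.ofReal_mul, Complex.norm_exp_ofReal_mul_I])
  have hl : Integrable (fun x : ℝ => (t : ℂ) * x * Complex.I) μ :=
    (hi.const_mul _).mul_const _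
  have hs : Integrable (fun x : ℝ => Complex.exp (t * x * Complex.I) - 1) μ :=
    he.sub (integrable_const _)
  have e1 : charFun μ t - (1 + t * A * Complex.I) =
      ∫ x : ℝ, (Complex.exp (t * x * Complex.I) - 1 - t * x * Complex.I) ∂μ := by
    rw [integral_sub hs hl, integral_sub he (integrable_const _),
      integral_mul_const, integral_const_mul, integral_complex_ofReal, h3, charFun_apply_real]
    simp
    ring
  rw [e1, ← integral_const_mul, ← integral_mul_const]
  refine norm_integral_le_of_norm_le ((h2.integrable_sq.const_mul 3).mul_const _)
    (.of_forall fun x => ?_)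
  have := norm_exp_mul_I_sub_one_sub_le (t * x)
  push_cast at this
  exact this.trans (le_of_eq (by ring))

lemma norm_pow_sub_pow_le {z w : ℂ} (hz : ‖z‖ ≤ 1) (hw : ‖w‖ ≤ 1) (n : ℕ) :
    ‖z ^ n - w ^ n‖ ≤ n * ‖z - w‖ := by
  induction n with
  | zero => simp
  | succ n ih =>
    have e : z ^ (n + 1) - w ^ (n + 1) = z ^ n * (z - w) + (z ^ n - w ^ n) * w := by ring
    rw [e]
    refine (norm_add_le _ _).trans ?_
    rw [norm_mul, norm_mul, norm_pow]
    have h1 : ‖z‖ ^ n * ‖z - w‖ ≤ 1 * ‖z - w‖ := by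
      gcongr
      exact pow_le_one₀ (norm_nonneg _) hz
    have h2 : ‖z ^ n - w ^ n‖ * ‖w‖ ≤ (n * ‖z - w‖) * 1 := by gcongr
    push_cast
    linarith

/-- Replacing the `s` factors, all of modulus at most `1`, costs at most `s K y ^ 2` at `y = t exp
(-m x)`. Integrating `exp (-2 m x)` gives the factor `1 / (2 m + 1)`; with `s = S + 1` the product
is `ratio`. -/
lemma norm_charFun_smoothing_sub_le {m : ℤ} (hm : (0 : ℝ) ≤ m) {p q s : ℕ} (hpq : p + q = s)
    {μ ν μ' ν' : Measure ℝ} [IsProbabilityMeasure μ] [IsProbabilityMeasure ν]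
    [IsProbabilityMeasure μ'] [IsProbabilityMeasure ν'] {K : ℝ}
    (h1 : ∀ t, ‖charFun μ t - charFun μ' t‖ ≤ K * t ^ 2)
    (h2 : ∀ t, ‖charFun ν t - charFun ν' t‖ ≤ K * t ^ 2) (t : ℝ) :
    ‖charFun (smoothing m p q μ ν) t - charFun (smoothing m p q μ' ν') t‖ ≤
      s / (2 * m + 1) * K * t ^ 2 := by
  rw [charFun_smoothing, charFun_smoothing]
  have hint : ∀ μ ν : Measure ℝ, IsProbabilityMeasure μ → IsProbabilityMeasure ν →
      Integrable (fun x => charFun μ (t * Real.exp (-(m : ℝ) * x)) ^ p *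
        charFun ν (t * Real.exp (-(m : ℝ) * x)) ^ q) (expMeasure 1) := by
    intro μ ν _ _
    have := measurable_charFun (μ := μ)
    have := measurable_charFun (μ := ν)
    refine Integrable.of_bound (Measurable.aestronglyMeasurable (by fun_prop)) 1
      (.of_forall fun x => ?_)
    rw [norm_mul, norm_pow, norm_pow]
    exact mul_le_one₀ (pow_le_one₀ (norm_nonneg _) (norm_charFun_le_one _))
      (by positivity) (pow_le_one₀ (norm_nonneg _) (norm_charFun_le_one _))
  rw [← integral_sub (hint μ ν ‹_› ‹_›) (hint μ' ν' ‹_› ‹_›)]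
  have hk := integral_exp_neg_mul_expMeasure_one (2 * (m : ℝ)) (by positivity)
  have e1 : (s : ℝ) / (2 * m + 1) * K * t ^ 2 =
      ∫ x, s * K * t ^ 2 * Real.exp (-(2 * (m : ℝ)) * x) ∂(expMeasure 1) := by
    rw [integral_const_mul, hk]
    ring
  rw [e1]
  refine norm_integral_le_of_norm_le
    ((integrable_exp_neg_mul_expMeasure_one _ (by positivity)).const_mul _)
    (.of_forall fun x => ?_)
  set y := t * Real.exp (-(m : ℝ) * x) with hy
  have hy2 : t ^ 2 * Real.exp (-(2 * (m : ℝ)) * x) = y ^ 2 := by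
    rw [hy, mul_pow, ← Real.exp_nat_mul]
    congr 2
    push_cast
    ring
  have e2 : charFun μ y ^ p * charFun ν y ^ q - charFun μ' y ^ p * charFun ν' y ^ q =
      charFun μ y ^ p * (charFun ν y ^ q - charFun ν' y ^ q) +
        (charFun μ y ^ p - charFun μ' y ^ p) * charFun ν' y ^ q := by ring
  have b1 : ‖charFun μ y ^ p * (charFun ν y ^ q - charFun ν' y ^ q)‖ ≤ 1 * (q * (K * y ^ 2)) := by
    rw [norm_mul, norm_pow]
    refine mul_le_mul (pow_le_one₀ (norm_nonneg _) (norm_charFun_le_one _)) ?_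
      (norm_nonneg _) zero_le_one
    refine (norm_pow_sub_pow_le (norm_charFun_le_one _) (norm_charFun_le_one _) q).trans ?_
    gcongr
    exact h2 y
  have b2 : ‖(charFun μ y ^ p - charFun μ' y ^ p) * charFun ν' y ^ q‖ ≤ p * (K * y ^ 2) * 1 := by
    rw [norm_mul, norm_pow]
    have h0 := (norm_pow_sub_pow_le (norm_charFun_le_one (μ := μ) y)
      (norm_charFun_le_one (μ := μ') y) p).trans
      (mul_le_mul_of_nonneg_left (h1 y) p.cast_nonneg)
    exact mul_le_mul h0 (pow_le_one₀ (norm_nonneg _) (norm_charFun_le_one _)) (by positivity)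
      ((norm_nonneg _).trans h0)
  rw [e2]
  refine (norm_add_le _ _).trans ((add_le_add b1 b2).trans (le_of_eq ?_))
  rw [mul_assoc _ (t ^ 2), hy2, ← hpq]
  push_cast
  ring

lemma IsSolution.unique (hbal : R.Balanced) (hm : (0 : ℝ) ≤ R.m) (hρ : ratio R < 1) {B C : ℝ}
    {μ ν μ' ν' : Measure ℝ} (hμ : μ ∈ M2 B) (hν : ν ∈ M2 C) (hμ' : μ' ∈ M2 B) (hν' : ν' ∈ M2 C)
    (h : IsSolution R μ ν) (h' : IsSolution R μ' ν') : μ = μ' ∧ ν = ν' := by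
  have := hμ.1
  have := hν.1
  have := hμ'.1
  have := hν'.1
  have hdiff : ∀ {A : ℝ} {π π' : Measure ℝ}, π ∈ M2 A → π' ∈ M2 A → ∀ t,
      ‖charFun π t - charFun π' t‖ ≤ (3 * (∫ x, x ^ 2 ∂π) + 3 * ∫ x, x ^ 2 ∂π') * t ^ 2 := by
    intro A π π' hπ hπ' t
    have e : charFun π t - charFun π' t = (charFun π t - (1 + t * A * Complex.I)) -
        (charFun π' t - (1 + t * A * Complex.I)) := by ring
    rw [e, add_mul]
    exact (norm_sub_le _ _).trans (add_le_add (norm_charFun_sub_le hπ t)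
      (norm_charFun_sub_le hπ' t))
  obtain ⟨K, hK1, hK2⟩ : ∃ K : ℝ, (∀ t, ‖charFun μ t - charFun μ' t‖ ≤ K * t ^ 2) ∧
      ∀ t, ‖charFun ν t - charFun ν' t‖ ≤ K * t ^ 2 :=
    ⟨max _ _, fun t => (hdiff hμ hμ' t).trans
        (mul_le_mul_of_nonneg_right (le_max_left _ _) (sq_nonneg t)),
      fun t => (hdiff hν hν' t).trans
        (mul_le_mul_of_nonneg_right (le_max_right _ _) (sq_nonneg t))⟩
  have hit : ∀ n : ℕ, (∀ t, ‖charFun μ t - charFun μ' t‖ ≤ ratio R ^ n * K * t ^ 2) ∧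
      ∀ t, ‖charFun ν t - charFun ν' t‖ ≤ ratio R ^ n * K * t ^ 2 := by
    intro n
    induction n with
    | zero => simpa using ⟨hK1, hK2⟩
    | succ n ih =>
      have hr : ratio R ^ (n + 1) * K = ((R.S + 1 : ℕ) : ℝ) / (2 * R.m + 1) * (ratio R ^ n * K) := by
        rw [pow_succ, ratio]
        push_cast
        ring
      rw [hr]
      constructor
      · intro t
        have e := norm_charFun_smoothing_sub_le hm (redCount_add_blackCount hbal .red) ih.1 ih.2 t
        simp only [redCount, blackCount] at e
        rwa [← h.1, ← h'.1] at e
      · intro t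
        have e := norm_charFun_smoothing_sub_le hm (redCount_add_blackCount hbal .black) ih.1 ih.2 t
        simp only [redCount, blackCount] at e
        rwa [← h.2, ← h'.2] at e
  have hzero : ∀ {f g : ℝ → ℂ}, (∀ n : ℕ, ∀ t, ‖f t - g t‖ ≤ ratio R ^ n * K * t ^ 2) →
      f = g := by
    intro f g hfg
    ext t
    have h0 : Tendsto (fun n => ratio R ^ n * K * t ^ 2) atTop (𝓝 (0 * K * t ^ 2)) :=
      ((tendsto_pow_atTop_nhds_zero_of_lt_one (ratio_pos hm).le hρ).mul_const _).mul_const _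
    have h1 := ge_of_tendsto' h0 fun n => hfg n t
    rw [zero_mul, zero_mul] at h1
    exact sub_eq_zero.1 (norm_le_zero_iff.1 h1)
  exact ⟨Measure.ext_of_charFun (hzero fun n => (hit n).1),
    Measure.ext_of_charFun (hzero fun n => (hit n).2)⟩

end PolyaUrn

end

/-! ### Proof of the theorem -/

theorem mainTheorem2 (R : PolyaUrn.ReplacementMatrix) (hbal : R.Balanced)
    (hnontriangular : R.b * R.c ≠ 0) (hlarge : 1 / 2 < R.sigma) :
    -- existence and uniqueness for all compatible expectations
    (∀ B C : ℝ, (R.c : ℝ) * B + (R.b : ℝ) * C = 0 →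
      ∃! p : Measure ℝ × Measure ℝ,
        (p.1 ∈ PolyaUrn.M2 B ∧ p.2 ∈ PolyaUrn.M2 C) ∧ PolyaUrn.IsSolution R p.1 p.2) ∧
    -- the urn processes and their limits are almost surely well defined
    (∀ᵐ ω ∂(PolyaUrn.clockLaw R), ∀ t : ℝ, (PolyaUrn.ballsAt ω t).Finite) ∧
    (∀ root : PolyaUrn.Color, ∀ᵐ ω ∂(PolyaUrn.clockLaw R),
      Tendsto (fun t : ℝ => PolyaUrn.normalizedProj R root t ω) atTop
        (𝓝 (PolyaUrn.limitW R root ω))) ∧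
    -- the pair of limit laws is the unique solution with these expectations
    (PolyaUrn.lawXCT R ∈ PolyaUrn.M2 ((R.b : ℝ) / R.S) ∧
      PolyaUrn.lawYCT R ∈ PolyaUrn.M2 (-((R.c : ℝ) / R.S)) ∧
      PolyaUrn.IsSolution R (PolyaUrn.lawXCT R) (PolyaUrn.lawYCT R)) ∧
    (∀ μ ν : Measure ℝ, μ ∈ PolyaUrn.M2 ((R.b : ℝ) / R.S) →
      ν ∈ PolyaUrn.M2 (-((R.c : ℝ) / R.S)) → PolyaUrn.IsSolution R μ ν →
      μ = PolyaUrn.lawXCT R ∧ ν = PolyaUrn.lawYCT R) := by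
  have hb : (0 : ℝ) < R.b := by
    exact_mod_cast Nat.pos_of_ne_zero (left_ne_zero_of_mul hnontriangular)
  have hS : (0 : ℝ) < R.S := by
    refine hb.trans_le ?_
    exact_mod_cast Nat.le_add_left R.b R.a
  have hlarge' : (R.S : ℝ) < 2 * R.m := by
    unfold PolyaUrn.ReplacementMatrix.sigma at hlarge
    rw [div_lt_div_iff₀ two_pos hS] at hlarge
    linarith
  have hm : (0 : ℝ) ≤ R.m := by linarith
  have hρ : PolyaUrn.ratio R < 1 := by
    unfold PolyaUrn.ratio
    rw [div_lt_one (by linarith)]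
    linarith
  -- Almost sure equality with the measurable `treeLim` identifies the laws, so the measurability of
  -- `limUnder` is never needed separately.
  have hX : PolyaUrn.lawXCT R = PolyaUrn.treeLaw R .red :=
    Measure.map_congr (PolyaUrn.ae_limitW_eq_treeLim hbal hm hρ .red)
  have hY : PolyaUrn.lawYCT R = PolyaUrn.treeLaw R .black :=
    Measure.map_congr (PolyaUrn.ae_limitW_eq_treeLim hbal hm hρ .black)
  have hXm : PolyaUrn.treeLaw R .red ∈ PolyaUrn.M2 ((R.b : ℝ) / R.S) :=
    PolyaUrn.treeLaw_mem_M2 hbal hm hρ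
  have hYm : PolyaUrn.treeLaw R .black ∈ PolyaUrn.M2 (-((R.c : ℝ) / R.S)) :=
    PolyaUrn.treeLaw_mem_M2 hbal hm hρ
  have hsol := PolyaUrn.isSolution_treeLaw hbal hm hρ
  rw [hX, hY]
  refine ⟨fun B C hBC => ?_, PolyaUrn.ae_ballsAt_finite hm hρ,
    PolyaUrn.ae_tendsto_normalizedProj hbal hm hρ, ⟨hXm, hYm, hsol⟩,
    fun μ ν hμ hν h => h.unique hbal hm hρ hμ hν hXm hYm hsol⟩
  have := hXm.1
  have := hYm.1
  -- The means `(b / S, -c / S)` span the line `c B + b C = 0`. As `b ≠ 0`, the factor is read off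
  -- from the first mean. For `B = 0` it is `0` and yields Dirac masses.
  have hB := PolyaUrn.map_mul_mem_M2 hXm (B * R.S / R.b)
  have hC := PolyaUrn.map_mul_mem_M2 hYm (B * R.S / R.b)
  rw [show B * R.S / R.b * ((R.b : ℝ) / R.S) = B by field_simp] at hB
  rw [show B * R.S / R.b * (-((R.c : ℝ) / R.S)) = C by
    field_simp
    linarith] at hC
  have hs := hsol.map_mul (B * R.S / R.b)
  refine ⟨(_, _), ⟨⟨hB, hC⟩, hs⟩, ?_⟩
  rintro ⟨μ, ν⟩ ⟨⟨hμ, hν⟩, h⟩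
  obtain ⟨rfl, rfl⟩ := h.unique hbal hm hρ hμ hν hB hC hs
  rfl
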